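/- Let $b\le 0$ and $c\ge 0$ be real constants, not both zero, and let $f\in C^2([0,1])$. For $0<\varepsilon\le 1$ let $u=u_\varepsilon\in H_0^1(0,1)$ be the weak solution of $$-\varepsilon u''-bu'+cu=f\ \text{ on }(0,1),\qquad u(0)=u(1)=0,$$ that is, $a(u,v)=(f,v)$ for all $v\in H^1_0(0,1)$, where $a(u,v)=\varepsilon(u',v')+b(u,v')+c(u,v)$ and $(\cdot,\cdot)$ is the $L^2(0,1)$ inner product. Suppose that a boundary layer can occur only at $x=1$: for every $\delta>0$ the derivatives $u_\varepsilon''$ are bounded on $(0,1-\delta)$ uniformly in $\varepsilon\in(0,1]$. For $n\ge2$ let $\mathcal T^n=\{x_i=i/(n+1): 0\le i\le n+1\}$ be the uniform grid, $\phi_1,\dots,\phi_n$ its piecewise linear nodal basis functions, $V^n$ their span, $u^n\in V^n$ the finite element solution ($a(u^n,v)=(f,v)$ for all $v\in V^n$), and $u^n_I=\sum_{i=1}^n u(x_i)\phi_i$ the interpolant of $u$. Let $A=(a(\phi_j,\phi_i))_{i,j=1}^n$, and let $A_i$ be $A$ with its $i$-th column replaced by $e_n=(0,\dots,0,1)^{T}$.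 For $2\le i\le n$ put $$x(Q_i)=\frac{r_i}{r_i+1}x_i+\frac1{r_i+1}x_{i-1},\qquad r_i=\left|\frac{\det A_{i-1}}{\det A_i}\right| .$$ Then for every real $\kappa$ there is a constant $C$, depending only on $b,c,f,\kappa$ (in particular not on $\varepsilon$ or $n$), such that the following holds for all $\varepsilon\in(0,1]$ and all $n\ge2$ for which * $\det A_i\cdot\det A_{i-1}<0$ for all $2\le i\le n$, and * $x_n$ lies outside the boundary layer, in the sense that $e^{-\lambda(1-x_n)}\le\kappa n^{-2}$, where $\lambda=\bigl(-b+\sqrt{b^2+4\varepsilon c}\bigr)/(2\varepsilon)$ is the exponential rate of the layer at $x=1$. For every $2\le i\le n$, $x(Q_i)$ is the abscissa of the intersection point $Q_i$, over the interval $(x_{i-1},x_i)$, of $u^n$ with the finite element solutions $u^{n+m}$ on the grids obtained from $\mathcal T^n$ by adding any $m$ points in $(x_n,1)$: $x(Q_i)\in(x_{i-1},x_i)$, every such $u^{n+m}$ agrees with $u^n$ at $x(Q_i)$, and at no other point of $(x_{i-1},x_i)$ unless the two functions coincide on $[x_{i-1},x_i]$. Moreover $$\max_{2\le i\le n}\bigl|u^n(x(Q_i))-u^n_I(x(Q_i))\bigr|<C\,n^{-2}.$$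 -/

import Mathlib

open Set MeasureTheory

noncomputable section

namespace SPFem

/-- Membership in `H₀¹(0,1)`, in terms of the continuous representative: an absolutely continuous
function on `[0,1]` whose (almost everywhere defined) derivative is square integrable, and which
vanishes at both end points. -/
def MemH10 (v : ℝ → ℝ) : Prop :=
  AbsolutelyContinuousOnInterval v 0 1 ∧ MemLp (deriv v) 2 (volume.restrict (Ioo (0 : ℝ) 1)) ∧
    v 0 = 0 ∧ v 1 = 0

/-- The `L²(0,1)` inner product. -/
def l2 (u v : ℝ → ℝ) : ℝ := ∫ t in (0 : ℝ)..1, u t * v t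

/-- The bilinear form `a(u,v) = ε (u',v') + b (u,v') + c (u,v)`. For the functions it is applied to
(elements of `H₀¹(0,1)`) the classical derivative exists almost everywhere and is the weak one. -/
def form (ε b c : ℝ) (u v : ℝ → ℝ) : ℝ :=
  ε * l2 (deriv u) (deriv v) + b * l2 u (deriv v) + c * l2 u v

/-- `u` is the weak solution of `-ε u'' - b u' + c u = f`, `u(0) = u(1) = 0`. -/
def IsWeakSolution (ε b c : ℝ) (f u : ℝ → ℝ) : Prop :=
  MemH10 u ∧ ∀ v, MemH10 v → form ε b c u v = l2 f v

/-- `0 = x 0 < x 1 < ⋯ < x (N+1) = 1`: a grid with `N` interior nodes (the values of `x` beyond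
`N + 1` play no role). -/
def IsGrid (N : ℕ) (x : ℕ → ℝ) : Prop :=
  x 0 = 0 ∧ x (N + 1) = 1 ∧ ∀ i ≤ N, x i < x (i + 1)

/-- The uniform grid on `[0,1]` with `n` interior nodes. -/
def uniformGrid (n : ℕ) (i : ℕ) : ℝ := (i : ℝ) / ((n : ℝ) + 1)

/-- The nodal basis function at `x i`, for `1 ≤ i`. -/
def nodal (x : ℕ → ℝ) (i : ℕ) (t : ℝ) : ℝ :=
  if t ∈ Icc (x (i - 1)) (x i) then (t - x (i - 1)) / (x i - x (i - 1))
  else if t ∈ Icc (x i) (x (i + 1)) then (x (i + 1) - t) / (x (i + 1) - x i)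
  else 0

/-- The finite element space, spanned by the nodal basis functions at `x 1, …, x N`. -/
def feSpace (N : ℕ) (x : ℕ → ℝ) : Submodule ℝ (ℝ → ℝ) :=
  Submodule.span ℝ (range fun j : Fin N => nodal x ((j : ℕ) + 1))

/-- `U` is the finite element solution on the grid `x` with `N` interior nodes. -/
def IsFEMSolution (ε b c : ℝ) (f : ℝ → ℝ) (N : ℕ) (x : ℕ → ℝ) (U : ℝ → ℝ) : Prop :=
  U ∈ feSpace N x ∧ ∀ V ∈ feSpace N x, form ε b c U V = l2 f V

/-- The piecewise linear interpolant `u_I` of `u` on the grid `x`. -/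
def interp (N : ℕ) (x : ℕ → ℝ) (u : ℝ → ℝ) (t : ℝ) : ℝ :=
  ∑ j : Fin N, u (x ((j : ℕ) + 1)) * nodal x ((j : ℕ) + 1) t

/-- The matrix `A` with entries `a(φ_j, φ_i)`, where row `k : Fin n` stands for the index `k + 1`. -/
def stiffness (ε b c : ℝ) (n : ℕ) (x : ℕ → ℝ) : Matrix (Fin n) (Fin n) ℝ :=
  Matrix.of fun k l => form ε b c (nodal x ((l : ℕ) + 1)) (nodal x ((k : ℕ) + 1))

/-- `det A_i` for `1 ≤ i ≤ n`, where `A_i` is `A` with its `i`-th column replaced by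
`e_n = (0, …, 0, 1)ᵀ`. -/
def detA (ε b c : ℝ) (n : ℕ) (x : ℕ → ℝ) (i : ℕ) : ℝ :=
  Matrix.det (Matrix.of fun k l : Fin n =>
    if (l : ℕ) + 1 = i then (if (k : ℕ) + 1 = n then (1 : ℝ) else 0)
    else stiffness ε b c n x k l)

/-- The sign condition `det A_i * det A_{i-1} < 0` for `i = 2, …, n`. -/
def SignCondition (ε b c : ℝ) (n : ℕ) (x : ℕ → ℝ) : Prop :=
  ∀ i, 2 ≤ i → i ≤ n → detA ε b c n x i * detA ε b c n x (i - 1) < 0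

/-- The abscissa of `Q_i`: `r/(r+1) x_i + 1/(r+1) x_{i-1}` with `r = |det A_{i-1} / det A_i|`. -/
def abscissaQ (ε b c : ℝ) (n : ℕ) (x : ℕ → ℝ) (i : ℕ) : ℝ :=
  let r := |detA ε b c n x (i - 1) / detA ε b c n x i|
  r / (r + 1) * x i + 1 / (r + 1) * x (i - 1)

/-- `X` is the abscissa of the intersection point, over `(x_{i-1}, x_i)`, of `un` with the finite
element solutions `U` on all the grids that arise from `x` by adding any number `m` of points
anywhere in `(x_n, 1)`: each `U` meets `un` at `X`, and nowhere else over this interval unless `U`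
and `un` coincide on it. -/
def IsIntersection (ε b c : ℝ) (f : ℝ → ℝ) (n : ℕ) (x : ℕ → ℝ) (un : ℝ → ℝ) (i : ℕ) (X : ℝ) :
    Prop :=
  X ∈ Ioo (x (i - 1)) (x i) ∧
    ∀ (m : ℕ) (y : ℕ → ℝ) (U : ℝ → ℝ), IsGrid (n + m) y → (∀ j ≤ n, y j = x j) →
      IsFEMSolution ε b c f (n + m) y U →
        U X = un X ∧
          ((∀ t ∈ Ioo (x (i - 1)) (x i), U t = un t → t = X) ∨
            EqOn U un (Icc (x (i - 1)) (x i)))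

/-- The family `u ε` of solutions has a boundary layer at most at `1`: away from `1` the second
derivatives are bounded uniformly in `ε`. -/
def BoundaryLayerAtOne (u : ℝ → ℝ → ℝ) : Prop :=
  ∀ δ > 0, ∃ K : ℝ, ∀ ε, 0 < ε → ε ≤ 1 → ∀ t ∈ Ioo (0 : ℝ) (1 - δ), |deriv (deriv (u ε)) t| ≤ K

/-- The rate of the layer at `1`: the positive root of `ε r² + b r - c = 0`, so that
`exp (-(layerRate ε b c) * (1 - t))` is the growing exponential solution of
`-ε w'' - b w' + c w = 0`, normalised to be `1` at `t = 1`. -/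
def layerRate (ε b c : ℝ) : ℝ := (-b + Real.sqrt (b ^ 2 + 4 * ε * c)) / (2 * ε)

/-- The point `p` lies outside the layer at `1`, to the accuracy `κ n⁻²`: the layer function has
decayed to `κ n⁻²` there. -/
def OutsideLayer (κ ε b c : ℝ) (n : ℕ) (p : ℝ) : Prop :=
  Real.exp (-(layerRate ε b c) * (1 - p)) ≤ κ / (n : ℝ) ^ 2

end SPFem

end

/-!
The proof works with the three-term recurrence `l e(i-1) + d e(i) + p e(i+1) = τ(i)`, `1 ≤ i < n`,
that the finite element equations impose on the nodal values; its coefficients are `lowerCoeff`,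
`diagCoeff` and `upperCoeff`. Refining the grid to the right of `x n` does not touch these
equations.

*Intersection points.* By Cramer's rule the numbers `det A_i` solve the homogeneous recurrence
(`detA_recurrence`), with the value `0` at the node `0`. The difference of two finite element
solutions solves it too, hence is proportional to `det A_i` at the nodes. The sign condition says
that this sequence alternates; with `γ i > 0` for its normalised absolute values, the difference
vanishes at the weighted mean of `x i` and `x (i - 1)` with weights `γ (i - 1)` and `γ i`, which is
the abscissa of `Q_i` (`exists_alternating_solution`, `isIntersection_of_alternating`).

*Stability at the points.* The value at `Q_i` of the piecewise affine function with nodal values `e`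
is the Casoratian `e (i - 1) * γ i + e i * γ (i - 1)` divided by `γ i + γ (i - 1)`. The Casoratian
satisfies a first-order recurrence (`casoratian_succ`), and after the division this recurrence is
stable uniformly in `ε` (`exists_casoratian_bound`), although the scheme itself is not: the
oscillating solution has been projected away. For `c > 0` the step is a contraction towards a ball
of radius of order `max |τ| / h`; for `c = 0` the error grows by at most a multiple of `max |τ|` in
each of at most `1 / h` steps.

*Consistency.* Write `u = S + E`, where `S` solves the differential equation with `S 0 = 0` and has
derivatives bounded uniformly in `ε`, and `E` is a bounded multiple of a layer function
(`exists_uniform_isRegularPart`, `IsRegularPart.exists_eq_add_layer`). For `b < 0` such an `S`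
exists for every right-hand side; for `b = 0` it exists if `f 0 = 0`, which is what the absence of a
layer at `0` means (`eq_zero_of_abs_deriv_deriv_le`). The nodal error of the finite element solution
against `S` has truncation errors of order `h ^ 3` (`abs_truncation_le`), and so it is of order
`h ^ 2` at the points `Q_i`. Replacing `S` by `u` at the nodes `x 1, …, x n` costs at most the size
of the layer function at `x n`, which is `O(n⁻²)` by assumption.
-/

/-! ### Three-term recurrences -/

/-- Where `g` solves the homogeneous three-term recurrence and changes sign at every step, the
normalised sequence `(-1) ^ (i + 1) * g i / g 1` is positive. -/
lemma alternating_normalised_pos {n : ℕ} {g : ℕ → ℝ}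
    (hg : ∀ i, 2 ≤ i → i ≤ n → g i * g (i - 1) < 0) (h1 : g 1 ≠ 0) :
    ∀ i, 1 ≤ i → i ≤ n → 0 < (-1) ^ (i + 1) * g i / g 1 := by
  intro i hi
  induction i, hi using Nat.le_induction with
  | base => intro _; simp [h1]
  | succ k hk ih =>
    intro hkn
    have h := ih (by omega)
    have h2 := hg (k + 1) (by omega) hkn
    rw [Nat.add_sub_cancel] at h2
    have hk0 : g k ≠ 0 := right_ne_zero_of_mul h2.ne
    have : (-1) ^ (k + 1 + 1) * g (k + 1) / g 1
        = (-(g (k + 1) * g k) / g k ^ 2) * ((-1) ^ (k + 1) * g k / g 1) := by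
      field_simp
      ring
    rw [this]
    exact mul_pos (div_pos (by linarith) (by positivity)) h

/-- The Casoratian of a solution `e` of the inhomogeneous recurrence and the alternating solution
`(-1) ^ i * γ i` of the homogeneous one satisfies a first-order recurrence. -/
lemma casoratian_succ {l d p τ e₀ e₁ e₂ γ₀ γ₁ γ₂ : ℝ}
    (hγ : p * γ₂ = d * γ₁ - l * γ₀) (he : l * e₀ + d * e₁ + p * e₂ = τ) :
    p * (e₁ * γ₂ + e₂ * γ₁) = -l * (e₀ * γ₁ + e₁ * γ₀) + γ₁ * τ := by
  linear_combination e₁ * hγ + γ₁ * he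

section Casoratian

variable {n : ℕ} {l d p σ T : ℝ} {γ e τ : ℕ → ℝ}

/-- If the row sum `σ = l + d + p` is positive, one step of the Casoratian recurrence divided by
`γ i + γ (i - 1)` is a contraction towards a ball of radius `3 T / σ`. For `l > 0` this uses that
`γ` is nondecreasing. -/
lemma casoratian_bound_of_rowSum_pos (hp : 0 < p) (hσ : 0 < σ) (hsum : l + d + p = σ)
    (hl : l ≤ σ / 6) (hd : l + p ≤ d) (γ0 : γ 0 = 0) (γpos : ∀ i, 1 ≤ i → i ≤ n → 0 < γ i)
    (hγ : ∀ i, 1 ≤ i → i < n → p * γ (i + 1) = d * γ i - l * γ (i - 1)) (e0 : e 0 = 0)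
    (he : ∀ i, 1 ≤ i → i < n → l * e (i - 1) + d * e i + p * e (i + 1) = τ i)
    (hτ : ∀ i, 1 ≤ i → i < n → |τ i| ≤ T) (hT : 0 ≤ T) :
    ∀ i, 1 ≤ i → i ≤ n →
      |e (i - 1) * γ i + e i * γ (i - 1)| ≤ 3 * T / σ * (γ i + γ (i - 1)) := by
  have γnn : ∀ i, i ≤ n → 0 ≤ γ i := by
    intro i hi
    rcases Nat.eq_zero_or_pos i with rfl | h
    · exact γ0.ge
    · exact (γpos i h hi).le
  have mono : 0 < l → ∀ i, 1 ≤ i → i ≤ n → γ (i - 1) ≤ γ i := by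
    intro hlpos i hi
    induction i, hi using Nat.le_induction with
    | base => intro h; simpa [γ0] using γnn 1 h
    | succ k hk ih =>
      intro hkn
      have h1 := ih (by omega)
      have h2 := hγ k hk (by omega)
      have h3 := γpos k hk (by omega)
      rw [Nat.add_sub_cancel]
      have : p * γ k ≤ p * γ (k + 1) := by
        rw [h2]
        nlinarith [mul_le_mul_of_nonneg_left h1 hlpos.le, mul_le_mul_of_nonneg_right hd h3.le]
      exact le_of_mul_le_mul_left this hp
  have hM : 0 ≤ 3 * T / σ := by positivity
  have hMσ : 3 * T / σ * σ = 3 * T := by field_simp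
  set M := 3 * T / σ
  intro i hi
  induction i, hi using Nat.le_induction with
  | base => intro h; simpa [γ0, e0] using mul_nonneg hM (γnn 1 h)
  | succ k hk ih =>
    intro hkn
    have hQ := ih (by omega)
    have hrec := casoratian_succ (hγ k hk (by omega)) (he k hk (by omega))
    have hk0 := γpos k hk (by omega)
    have hk1 := γnn (k - 1) (by omega)
    have hγk := hγ k hk (by omega)
    have hτk := hτ k hk (by omega)
    rw [Nat.add_sub_cancel]
    set Q := e (k - 1) * γ k + e k * γ (k - 1)
    set D := γ k + γ (k - 1)
    have hD : p * (γ (k + 1) + γ k) = σ * γ k - l * D := by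
      simp only [D]
      linear_combination hγk + γ k * hsum
    have key : |p * (e k * γ (k + 1) + e (k + 1) * γ k)| ≤ |l| * (M * D) + γ k * T := by
      rw [hrec]
      refine (abs_add_le _ _).trans ?_
      rw [abs_mul, abs_mul, abs_neg, abs_of_pos hk0]
      gcongr
    rw [abs_mul, abs_of_pos hp] at key
    refine le_of_mul_le_mul_left (key.trans ?_) hp
    have : p * (M * (γ (k + 1) + γ k)) = 3 * T * γ k - l * (M * D) := by
      linear_combination M * hD + γ k * hMσ
    rw [this]
    rcases le_or_gt l 0 with hl0 | hl0
    · rw [abs_of_nonpos hl0]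
      nlinarith [mul_nonneg hT hk0.le]
    · rw [abs_of_pos hl0]
      have hDk : D ≤ 2 * γ k := by
        have := mono hl0 k hk (by omega)
        simp only [D]; linarith
      have h1 : l * (M * D) ≤ σ / 6 * (M * (2 * γ k)) := by
        gcongr
      have h2 : σ / 6 * (M * (2 * γ k)) = T * γ k := by
        linear_combination γ k / 3 * hMσ
      linarith [mul_comm T (γ k)]

/-- If the row sum `l + d + p` vanishes, the Casoratian divided by `γ i + γ (i - 1)` grows by at
most `T / (-l)` in each step. -/
lemma casoratian_bound_of_rowSum_zero (hp : 0 < p) (hl : l < 0) (hsum : l + d + p = 0)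
    (γ0 : γ 0 = 0) (γpos : ∀ i, 1 ≤ i → i ≤ n → 0 < γ i)
    (hγ : ∀ i, 1 ≤ i → i < n → p * γ (i + 1) = d * γ i - l * γ (i - 1)) (e0 : e 0 = 0)
    (he : ∀ i, 1 ≤ i → i < n → l * e (i - 1) + d * e i + p * e (i + 1) = τ i)
    (hτ : ∀ i, 1 ≤ i → i < n → |τ i| ≤ T) (hT : 0 ≤ T) :
    ∀ i, 1 ≤ i → i ≤ n →
      |e (i - 1) * γ i + e i * γ (i - 1)| ≤ i * (T / -l) * (γ i + γ (i - 1)) := by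
  have γnn : ∀ i, i ≤ n → 0 ≤ γ i := by
    intro i hi
    rcases Nat.eq_zero_or_pos i with rfl | h
    · exact γ0.ge
    · exact (γpos i h hi).le
  have hl' : 0 < -l := by linarith
  have hM : 0 ≤ T / -l := by positivity
  have hMl : T / -l * l = -T := by linarith [div_mul_cancel₀ T hl'.ne']
  set M := T / -l
  intro i hi
  induction i, hi using Nat.le_induction with
  | base => intro h; simpa [γ0, e0] using mul_nonneg hM (γnn 1 h)
  | succ k hk ih =>
    intro hkn
    have hQ := ih (by omega)
    have hrec := casoratian_succ (hγ k hk (by omega)) (he k hk (by omega))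
    have hk0 := γpos k hk (by omega)
    have hk1 := γnn (k - 1) (by omega)
    have hγk := hγ k hk (by omega)
    have hτk := hτ k hk (by omega)
    rw [Nat.add_sub_cancel]
    set Q := e (k - 1) * γ k + e k * γ (k - 1)
    set D := γ k + γ (k - 1)
    have hD : p * (γ (k + 1) + γ k) = -l * D := by
      simp only [D]
      linear_combination hγk + γ k * hsum
    have key : |p * (e k * γ (k + 1) + e (k + 1) * γ k)| ≤ -l * (k * M * D) + γ k * T := by
      rw [hrec]
      refine (abs_add_le _ _).trans ?_
      rw [abs_mul, abs_mul, abs_of_pos hl', abs_of_pos hk0]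
      gcongr
    rw [abs_mul, abs_of_pos hp] at key
    refine le_of_mul_le_mul_left (key.trans ?_) hp
    have : p * (((k + 1 : ℕ) : ℝ) * M * (γ (k + 1) + γ k)) = -l * (k * M * D) + T * D := by
      push_cast
      linear_combination (k + 1) * M * hD - D * hMl
    rw [this]
    nlinarith [mul_nonneg hT hk1]

end Casoratian

/-! ### Finite element functions on a grid -/

/-- On `[a, b]` the function `w` is affine. The denominator of the interpolation formula is cleared,
which makes the condition linear in `w`. -/
def AffineOnIcc (w : ℝ → ℝ) (a b : ℝ) : Prop :=
  ∀ t ∈ Icc a b, w t * (b - a) = w a * (b - t) + w b * (t - a)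

lemma AffineOnIcc.eq {w : ℝ → ℝ} {a b t : ℝ} (hw : AffineOnIcc w a b) (hab : a < b)
    (ht : t ∈ Icc a b) : w t = w a + (w b - w a) / (b - a) * (t - a) := by
  have h : b - a ≠ 0 := by linarith
  have := hw t ht
  field_simp
  linear_combination this

lemma AffineOnIcc.deriv_eq {w : ℝ → ℝ} {a b t : ℝ} (hw : AffineOnIcc w a b) (ht : t ∈ Ioo a b) :
    deriv w t = (w b - w a) / (b - a) := by
  have hab : a < b := ht.1.trans ht.2
  have hev : w =ᶠ[nhds t] fun s => w a + (w b - w a) / (b - a) * (s - a) :=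
    Filter.eventuallyEq_of_mem (Ioo_mem_nhds ht.1 ht.2)
      fun s hs => hw.eq hab (Ioo_subset_Icc_self hs)
  rw [hev.deriv_eq]
  simp

lemma deriv_eq_zero_of_eqOn_Ioo {w : ℝ → ℝ} {a b t : ℝ} (hw : ∀ s ∈ Ioo a b, w s = 0)
    (ht : t ∈ Ioo a b) : deriv w t = 0 := by
  have hev : w =ᶠ[nhds t] fun _ => (0 : ℝ) :=
    Filter.eventuallyEq_of_mem (Ioo_mem_nhds ht.1 ht.2) hw
  rw [hev.deriv_eq]
  simp

lemma integral_zero_one_of_pieces {g g₁ g₂ : ℝ → ℝ} {a m e : ℝ} (ha : 0 ≤ a) (ham : a ≤ m)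
    (hme : m ≤ e) (he : e ≤ 1) (h0 : ∀ t ∈ Ioo 0 a, g t = 0) (h1 : ∀ t ∈ Ioo a m, g t = g₁ t)
    (h2 : ∀ t ∈ Ioo m e, g t = g₂ t) (h3 : ∀ t ∈ Ioo e 1, g t = 0) (c1 : Continuous g₁)
    (c2 : Continuous g₂) :
    ∫ t in (0 : ℝ)..1, g t = (∫ t in a..m, g₁ t) + ∫ t in m..e, g₂ t := by
  have i0 : IntervalIntegrable g volume 0 a :=
    (intervalIntegrable_const (c := (0 : ℝ))).congr_uIoo
      (by rw [uIoo_of_le ha]; exact fun t ht => (h0 t ht).symm)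
  have i1 : IntervalIntegrable g volume a m :=
    (c1.intervalIntegrable a m).congr_uIoo
      (by rw [uIoo_of_le ham]; exact fun t ht => (h1 t ht).symm)
  have i2 : IntervalIntegrable g volume m e :=
    (c2.intervalIntegrable m e).congr_uIoo
      (by rw [uIoo_of_le hme]; exact fun t ht => (h2 t ht).symm)
  have i3 : IntervalIntegrable g volume e 1 :=
    (intervalIntegrable_const (c := (0 : ℝ))).congr_uIoo
      (by rw [uIoo_of_le he]; exact fun t ht => (h3 t ht).symm)
  rw [← intervalIntegral.integral_add_adjacent_intervals ((i0.trans i1).trans i2) i3,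
    ← intervalIntegral.integral_add_adjacent_intervals (i0.trans i1) i2,
    ← intervalIntegral.integral_add_adjacent_intervals i0 i1,
    intervalIntegral.integral_congr_Ioo_of_le ha (g := fun _ => (0 : ℝ)) h0,
    intervalIntegral.integral_congr_Ioo_of_le ham h1,
    intervalIntegral.integral_congr_Ioo_of_le hme h2,
    intervalIntegral.integral_congr_Ioo_of_le he (g := fun _ => (0 : ℝ)) h3]
  simp

lemma integral_affine_mul_affine (a b α₀ α₁ β₀ β₁ : ℝ) :
    ∫ t in a..b, (α₀ + α₁ * (t - a)) * (β₀ + β₁ * (t - a)) =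
      α₀ * β₀ * (b - a) + (α₀ * β₁ + α₁ * β₀) * (b - a) ^ 2 / 2 + α₁ * β₁ * (b - a) ^ 3 / 3 := by
  rw [intervalIntegral.integral_eq_sub_of_hasDerivAt (f := fun t =>
      α₀ * β₀ * (t - a) + (α₀ * β₁ + α₁ * β₀) * (t - a) ^ 2 / 2 + α₁ * β₁ * (t - a) ^ 3 / 3)]
  · simp
  · intro t _
    have h := (hasDerivAt_id t).sub_const a
    refine HasDerivAt.congr_deriv (((h.const_mul (α₀ * β₀)).add
      (((h.pow 2).const_mul (α₀ * β₁ + α₁ * β₀)).div_const 2)).add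
      (((h.pow 3).const_mul (α₁ * β₁)).div_const 3)) ?_
    simp
    ring
  · exact (by fun_prop : Continuous _).intervalIntegrable _ _

namespace SPFem

/-- The subdiagonal entry of the stiffness matrix for step size `h`. -/
noncomputable def lowerCoeff (ε b c h : ℝ) : ℝ := -(ε / h) + b / 2 + c * h / 6

/-- The diagonal entry of the stiffness matrix for step size `h`. -/
noncomputable def diagCoeff (ε c h : ℝ) : ℝ := 2 * (ε / h) + 2 * c * h / 3

/-- The superdiagonal entry of the stiffness matrix for step size `h`. -/
noncomputable def upperCoeff (ε b c h : ℝ) : ℝ := -(ε / h) - b / 2 + c * h / 6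

/-- The three-point formula for `a(U, V)` where `V` is a hat function of width `2 h` and `U` is
affine on both halves of its support. -/
lemma form_hat {ε b c h m : ℝ} {U V : ℝ → ℝ} (hh : 0 < h) (hm : 0 ≤ m - h) (hm' : m + h ≤ 1)
    (hU : AffineOnIcc U (m - h) m) (hU' : AffineOnIcc U m (m + h))
    (hV : AffineOnIcc V (m - h) m) (hV' : AffineOnIcc V m (m + h))
    (Vm : V m = 1) (Vl : V (m - h) = 0) (Vr : V (m + h) = 0)
    (V0 : ∀ t, t < m - h ∨ m + h < t → V t = 0) :
    form ε b c U V = lowerCoeff ε b c h * U (m - h) + diagCoeff ε c h * U m +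
      upperCoeff ε b c h * U (m + h) := by
  have e1 : m - (m - h) = h := by ring
  have e2 : m + h - m = h := by ring
  have l1 : m - h < m := by linarith
  have l2' : m < m + h := by linarith
  have V0l : ∀ t ∈ Ioo 0 (m - h), V t = 0 := fun t ht => V0 t (.inl ht.2)
  have V0r : ∀ t ∈ Ioo (m + h) 1, V t = 0 := fun t ht => V0 t (.inr ht.1)
  have dV0l : ∀ t ∈ Ioo 0 (m - h), deriv V t = 0 := fun t ht => deriv_eq_zero_of_eqOn_Ioo V0l ht
  have dV0r : ∀ t ∈ Ioo (m + h) 1, deriv V t = 0 := fun t ht => deriv_eq_zero_of_eqOn_Ioo V0r ht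
  have hdd : l2 (deriv U) (deriv V) = (2 * U m - U (m - h) - U (m + h)) / h := by
    unfold l2
    rw [integral_zero_one_of_pieces (a := m - h) (m := m) (e := m + h)
      (g₁ := fun t => ((U m - U (m - h)) / h + 0 * (t - (m - h))) * (1 / h + 0 * (t - (m - h))))
      (g₂ := fun t => ((U (m + h) - U m) / h + 0 * (t - m)) * (-1 / h + 0 * (t - m)))
      hm l1.le l2'.le hm' (fun t ht => by rw [dV0l t ht, mul_zero])
      (fun t ht => by rw [hU.deriv_eq ht, hV.deriv_eq ht, e1, Vm, Vl]; simp)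
      (fun t ht => by rw [hU'.deriv_eq ht, hV'.deriv_eq ht, e2, Vm, Vr]; simp)
      (fun t ht => by rw [dV0r t ht, mul_zero]) (by fun_prop) (by fun_prop),
      integral_affine_mul_affine, integral_affine_mul_affine, e1, e2]
    field_simp
    ring
  have hd : l2 U (deriv V) = (U (m - h) - U (m + h)) / 2 := by
    unfold l2
    rw [integral_zero_one_of_pieces (a := m - h) (m := m) (e := m + h)
      (g₁ := fun t => (U (m - h) + (U m - U (m - h)) / h * (t - (m - h))) *
        (1 / h + 0 * (t - (m - h))))
      (g₂ := fun t => (U m + (U (m + h) - U m) / h * (t - m)) * (-1 / h + 0 * (t - m)))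
      hm l1.le l2'.le hm' (fun t ht => by rw [dV0l t ht, mul_zero])
      (fun t ht => by
        rw [hU.eq l1 (Ioo_subset_Icc_self ht), hV.deriv_eq ht, e1, Vm, Vl]; simp)
      (fun t ht => by
        rw [hU'.eq l2' (Ioo_subset_Icc_self ht), hV'.deriv_eq ht, e2, Vm, Vr]; simp)
      (fun t ht => by rw [dV0r t ht, mul_zero]) (by fun_prop) (by fun_prop),
      integral_affine_mul_affine, integral_affine_mul_affine, e1, e2]
    field_simp
    ring
  have h00 : l2 U V = h * (U (m - h) + 4 * U m + U (m + h)) / 6 := by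
    unfold l2
    rw [integral_zero_one_of_pieces (a := m - h) (m := m) (e := m + h)
      (g₁ := fun t => (U (m - h) + (U m - U (m - h)) / h * (t - (m - h))) *
        (0 + 1 / h * (t - (m - h))))
      (g₂ := fun t => (U m + (U (m + h) - U m) / h * (t - m)) * (1 + -1 / h * (t - m)))
      hm l1.le l2'.le hm' (fun t ht => by rw [V0l t ht, mul_zero])
      (fun t ht => by
        rw [hU.eq l1 (Ioo_subset_Icc_self ht), hV.eq l1 (Ioo_subset_Icc_self ht), e1, Vm, Vl]
        simp)
      (fun t ht => by
        rw [hU'.eq l2' (Ioo_subset_Icc_self ht), hV'.eq l2' (Ioo_subset_Icc_self ht), e2, Vm, Vr]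
        simp)
      (fun t ht => by rw [V0r t ht, mul_zero]) (by fun_prop) (by fun_prop),
      integral_affine_mul_affine, integral_affine_mul_affine, e1, e2]
    field_simp
    ring
  unfold form
  rw [hdd, hd, h00]
  unfold lowerCoeff diagCoeff upperCoeff
  ring

variable {N : ℕ} {x : ℕ → ℝ}

lemma IsGrid.lt_of_lt (hx : IsGrid N x) {i j : ℕ} (hij : i < j) (hj : j ≤ N + 1) : x i < x j := by
  induction j, hij using Nat.le_induction with
  | base => exact hx.2.2 i (by omega)
  | succ k hk ih => exact (ih (by omega)).trans (hx.2.2 k (by omega))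

lemma IsGrid.le_of_le (hx : IsGrid N x) {i j : ℕ} (hij : i ≤ j) (hj : j ≤ N + 1) : x i ≤ x j := by
  rcases hij.eq_or_lt with rfl | h
  · exact le_rfl
  · exact (hx.lt_of_lt h hj).le

lemma isGrid_uniformGrid (n : ℕ) : IsGrid n (uniformGrid n) := by
  have : (0 : ℝ) < n + 1 := by positivity
  refine ⟨by simp [uniformGrid], ?_, fun i _ => ?_⟩
  · simp [uniformGrid, this.ne']
  · simp only [uniformGrid]
    push_cast
    gcongr
    linarith

lemma nodal_of_mem_left {j : ℕ} {t : ℝ} (ht : t ∈ Icc (x (j - 1)) (x j)) :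
    nodal x j t = (t - x (j - 1)) / (x j - x (j - 1)) := by
  simp only [nodal, ht, if_true]

lemma nodal_of_mem_right {j : ℕ} {t : ℝ} (h : x (j - 1) < x j) (h' : x j < x (j + 1))
    (ht : t ∈ Icc (x j) (x (j + 1))) :
    nodal x j t = (x (j + 1) - t) / (x (j + 1) - x j) := by
  simp only [nodal]
  split_ifs with h1
  · have : t = x j := le_antisymm h1.2 ht.1
    rw [this, div_self (by linarith), div_self (by linarith)]
  · rfl

lemma nodal_of_notMem {j : ℕ} {t : ℝ} (h : x (j - 1) < x j) (h' : x j < x (j + 1))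
    (ht : t ≤ x (j - 1) ∨ x (j + 1) ≤ t) : nodal x j t = 0 := by
  rcases ht with ht | ht
  · rcases ht.eq_or_lt with rfl | ht
    · rw [nodal_of_mem_left ⟨le_rfl, h.le⟩]; simp
    · simp only [nodal, mem_Icc]
      rw [if_neg (by rintro ⟨_, _⟩; linarith), if_neg (by rintro ⟨_, _⟩; linarith)]
  · rcases ht.eq_or_lt with rfl | ht
    · rw [nodal_of_mem_right h h' ⟨h'.le, le_rfl⟩]; simp
    · simp only [nodal, mem_Icc]
      rw [if_neg (by rintro ⟨_, _⟩; linarith), if_neg (by rintro ⟨_, _⟩; linarith)]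

lemma affineOnIcc_nodal_left {j : ℕ} (h : x (j - 1) < x j) :
    AffineOnIcc (nodal x j) (x (j - 1)) (x j) := by
  intro t ht
  have : x j - x (j - 1) ≠ 0 := by linarith
  rw [nodal_of_mem_left ht, nodal_of_mem_left ⟨le_rfl, h.le⟩, nodal_of_mem_left ⟨h.le, le_rfl⟩]
  field_simp
  ring

lemma affineOnIcc_nodal_right {j : ℕ} (h : x (j - 1) < x j) (h' : x j < x (j + 1)) :
    AffineOnIcc (nodal x j) (x j) (x (j + 1)) := by
  intro t ht
  have : x (j + 1) - x j ≠ 0 := by linarith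
  rw [nodal_of_mem_right h h' ht, nodal_of_mem_right h h' ⟨le_rfl, h'.le⟩,
    nodal_of_mem_right h h' ⟨h'.le, le_rfl⟩]
  field_simp
  ring

lemma IsGrid.affineOnIcc_nodal (hx : IsGrid N x) {i j : ℕ} (hj : 1 ≤ j) (hjN : j ≤ N)
    (hi : i ≤ N) : AffineOnIcc (nodal x j) (x i) (x (i + 1)) := by
  have h : x (j - 1) < x j := hx.lt_of_lt (by omega) (by omega)
  have h' : x j < x (j + 1) := hx.lt_of_lt (by omega) (by omega)
  have hi1 : x i < x (i + 1) := hx.2.2 i hi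
  rcases lt_trichotomy i j with hij | rfl | hij
  · rcases Nat.lt_or_ge (i + 1) j with h1 | h1
    · have h2 : x (i + 1) ≤ x (j - 1) := hx.le_of_le (by omega) (by omega)
      intro t ht
      rw [nodal_of_notMem h h' (.inl (ht.2.trans h2)), nodal_of_notMem h h' (.inl h2),
        nodal_of_notMem h h' (.inl (hi1.le.trans h2))]
      ring
    · obtain rfl : j = i + 1 := by omega
      exact affineOnIcc_nodal_left h
  · exact affineOnIcc_nodal_right h h'
  · have h2 : x (j + 1) ≤ x i := hx.le_of_le (by omega) (by omega)
    intro t ht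
    rw [nodal_of_notMem h h' (.inr (h2.trans ht.1)), nodal_of_notMem h h' (.inr h2),
      nodal_of_notMem h h' (.inr (h2.trans hi1.le))]
    ring

lemma IsGrid.nodal_node (hx : IsGrid N x) {i j : ℕ} (hj : 1 ≤ j) (hjN : j ≤ N)
    (hi : i ≤ N + 1) : nodal x j (x i) = if i = j then 1 else 0 := by
  have h : x (j - 1) < x j := hx.lt_of_lt (by omega) (by omega)
  have h' : x j < x (j + 1) := hx.lt_of_lt (by omega) (by omega)
  rcases lt_trichotomy i j with hij | rfl | hij
  · rw [if_neg hij.ne, nodal_of_notMem h h' (.inl (hx.le_of_le (by omega) (by omega)))]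
  · rw [if_pos rfl, nodal_of_mem_left ⟨h.le, le_rfl⟩, div_self (by linarith)]
  · rw [if_neg hij.ne', nodal_of_notMem h h' (.inr (hx.le_of_le (by omega) (by omega)))]

lemma IsGrid.feSpace_properties (hx : IsGrid N x) {U : ℝ → ℝ} (hU : U ∈ feSpace N x) :
    (∀ i ≤ N, AffineOnIcc U (x i) (x (i + 1))) ∧ U (x 0) = 0 := by
  induction hU using Submodule.span_induction with
  | mem w hw =>
    obtain ⟨j, rfl⟩ := hw
    have := j.isLt
    refine ⟨fun i hi => hx.affineOnIcc_nodal (by omega) (by omega) hi, ?_⟩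
    simp only [hx.nodal_node (i := 0) (j := (j : ℕ) + 1) (by omega) (by omega) (by omega)]
    simp
  | zero => exact ⟨fun i _ t _ => by simp, rfl⟩
  | add v w _ _ hv hw =>
    refine ⟨fun i hi t ht => ?_, by simp [hv.2, hw.2]⟩
    have h1 := hv.1 i hi t ht
    have h2 := hw.1 i hi t ht
    simp only [Pi.add_apply]
    linear_combination h1 + h2
  | smul r v _ hv =>
    refine ⟨fun i hi t ht => ?_, by simp [hv.2]⟩
    have h1 := hv.1 i hi t ht
    simp only [Pi.smul_apply, smul_eq_mul]
    linear_combination r * h1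

lemma nodal_mem_feSpace {j : ℕ} (hj : 1 ≤ j) (hjN : j ≤ N) : nodal x j ∈ feSpace N x := by
  refine Submodule.subset_span ⟨⟨j - 1, by omega⟩, ?_⟩
  simp only [Nat.sub_add_cancel hj]

lemma IsGrid.sum_nodal_node (hx : IsGrid N x) (w : Fin N → ℝ) (i : Fin N) :
    ∑ j : Fin N, w j * nodal x ((j : ℕ) + 1) (x ((i : ℕ) + 1)) = w i := by
  rw [Finset.sum_eq_single i]
  · have := i.isLt
    rw [hx.nodal_node (by omega) (by omega) (by omega)]
    simp
  · intro j _ hji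
    have := i.isLt
    have := j.isLt
    rw [hx.nodal_node (by omega) (by omega) (by omega), if_neg, mul_zero]
    intro h
    exact hji (Fin.ext (by omega))
  · simp

lemma interp_mem_feSpace (u : ℝ → ℝ) : interp N x u ∈ feSpace N x := by
  have : interp N x u = ∑ j : Fin N, u (x ((j : ℕ) + 1)) • nodal x ((j : ℕ) + 1) := by
    ext t
    simp [interp]
  rw [this]
  exact Submodule.sum_mem _ fun j _ => Submodule.smul_mem _ _ (Submodule.subset_span ⟨j, rfl⟩)

lemma IsGrid.interp_node (hx : IsGrid N x) (u : ℝ → ℝ) {i : ℕ} (hi : 1 ≤ i) (hiN : i ≤ N) :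
    interp N x u (x i) = u (x i) := by
  have := hx.sum_nodal_node (fun j => u (x ((j : ℕ) + 1))) ⟨i - 1, by omega⟩
  simpa only [interp, Nat.sub_add_cancel hi] using this

/-- The entries of the stiffness matrix of a grid that is locally uniform at `x j`, in the form in
which they act on the nodal values of a piecewise affine function. -/
lemma form_nodal {ε b c h : ℝ} {U : ℝ → ℝ} {j : ℕ} (hh : 0 < h) (hl : x (j - 1) = x j - h)
    (hr : x (j + 1) = x j + h) (h0 : 0 ≤ x j - h) (h1 : x j + h ≤ 1)
    (hU : AffineOnIcc U (x (j - 1)) (x j)) (hU' : AffineOnIcc U (x j) (x (j + 1))) :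
    form ε b c U (nodal x j) = lowerCoeff ε b c h * U (x (j - 1)) + diagCoeff ε c h * U (x j) +
      upperCoeff ε b c h * U (x (j + 1)) := by
  have hlt : x (j - 1) < x j := by linarith
  have hlt' : x j < x (j + 1) := by linarith
  have hV := affineOnIcc_nodal_left hlt
  have hV' := affineOnIcc_nodal_right hlt hlt'
  have Vm : nodal x j (x j) = 1 := by
    rw [nodal_of_mem_left ⟨hlt.le, le_rfl⟩, div_self (by linarith)]
  have Vl := nodal_of_notMem hlt hlt' (.inl le_rfl)
  have Vr := nodal_of_notMem hlt hlt' (.inr le_rfl)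
  rw [hl, hr]
  rw [hl] at hU hV Vl
  rw [hr] at hU' hV' Vr
  refine form_hat hh h0 h1 hU hU' hV hV' Vm Vl Vr fun t ht => nodal_of_notMem hlt hlt' ?_
  rw [hl, hr]
  exact ht.imp le_of_lt le_of_lt

end SPFem

/-! ### Consistency of the three-point scheme -/

lemma abs_integral_sub_le {F P P' : ℝ → ℝ} {a b B : ℝ} (hab : a ≤ b)
    (hP : ∀ t, HasDerivAt P (P' t) t) (cP : Continuous P') (cF : Continuous F)
    (hB : ∀ t ∈ Icc a b, |F t - P' t| ≤ B) :
    |(∫ t in a..b, F t) - (P b - P a)| ≤ B * (b - a) := by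
  rw [← intervalIntegral.integral_eq_sub_of_hasDerivAt (fun t _ => hP t)
    (cP.intervalIntegrable a b),
    ← intervalIntegral.integral_sub (cF.intervalIntegrable a b) (cP.intervalIntegrable a b)]
  have := intervalIntegral.norm_integral_le_of_norm_le_const (a := a) (b := b) (C := B)
    (f := fun t => F t - P' t) fun t ht => by
      rw [uIoc_of_le hab] at ht
      exact hB t (Ioc_subset_Icc_self ht)
  rwa [abs_of_nonneg (by linarith : 0 ≤ b - a)] at this

lemma abs_sub_le_of_abs_deriv_le {F F' : ℝ → ℝ} {m h B t : ℝ} (hh : 0 ≤ h) (hB0 : 0 ≤ B)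
    (hF : ∀ t, HasDerivAt F (F' t) t) (hB : ∀ t ∈ Icc (m - h) (m + h), |F' t| ≤ B)
    (ht : t ∈ Icc (m - h) (m + h)) : |F t - F m| ≤ B * h := by
  have hm : m ∈ Icc (m - h) (m + h) := ⟨by linarith, by linarith⟩
  have h1 := Convex.norm_image_sub_le_of_norm_hasDerivWithin_le (f := F) (f' := F')
    (fun x _ => (hF x).hasDerivWithinAt) hB (convex_Icc _ _) hm ht
  have h2 : |t - m| ≤ h := abs_le.2 ⟨by linarith [ht.1], by linarith [ht.2]⟩
  exact h1.trans (mul_le_mul_of_nonneg_left h2 hB0)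

lemma abs_taylor_one_le {F F' : ℝ → ℝ} {m h B t : ℝ} (hh : 0 ≤ h) (hB0 : 0 ≤ B)
    (hF : ∀ t, HasDerivAt F (F' t) t) (hB : ∀ t ∈ Icc (m - h) (m + h), |F' t - F' m| ≤ B)
    (ht : t ∈ Icc (m - h) (m + h)) : |F t - F m - (t - m) * F' m| ≤ B * h := by
  have := abs_sub_le_of_abs_deriv_le (F := fun t => F t - (t - m) * F' m)
    (F' := fun t => F' t - F' m) hh hB0
    (fun t => by
      have := (hF t).sub (((hasDerivAt_id t).sub_const m).mul_const (F' m))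
      rwa [one_mul] at this) hB ht
  simpa [sub_right_comm] using this

namespace SPFem

variable {x : ℕ → ℝ}

lemma l2_nodal {f f₀ : ℝ → ℝ} {h : ℝ} {j : ℕ} (hh : 0 < h) (hl : x (j - 1) = x j - h)
    (hr : x (j + 1) = x j + h) (h0 : 0 ≤ x j - h) (h1 : x j + h ≤ 1)
    (hf : ∀ t ∈ Icc (0 : ℝ) 1, f t = f₀ t) (cf : Continuous f₀) :
    l2 f (nodal x j) = (∫ t in (x j - h)..x j, f₀ t * ((t - (x j - h)) / h)) +
      ∫ t in x j..(x j + h), f₀ t * ((x j + h - t) / h) := by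
  have hlt : x (j - 1) < x j := by linarith
  have hlt' : x j < x (j + 1) := by linarith
  unfold l2
  refine integral_zero_one_of_pieces h0 (by linarith) (by linarith) h1 (fun t ht => ?_)
    (fun t ht => ?_) (fun t ht => ?_) (fun t ht => ?_) (by fun_prop) (by fun_prop)
  · rw [nodal_of_notMem hlt hlt' (.inl (by rw [hl]; exact ht.2.le)), mul_zero]
  · rw [nodal_of_mem_left (by rw [hl]; exact Ioo_subset_Icc_self ht), hl,
      hf t ⟨by linarith [ht.1], by linarith [ht.2]⟩, sub_sub_cancel]
  · rw [nodal_of_mem_right hlt hlt' (by rw [hr]; exact Ioo_subset_Icc_self ht), hr,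
      hf t ⟨by linarith [ht.1], by linarith [ht.2]⟩, add_sub_cancel_left]
  · rw [nodal_of_notMem hlt hlt' (.inr (by rw [hr]; exact ht.1.le)), mul_zero]

section Halves

variable {ε h m α β B : ℝ} {f₀ S S' S'' : ℝ → ℝ}

/-- The load of the rising half of a hat function, for `f₀` close to `-ε S''` plus an affine
function. -/
lemma abs_integral_left_half_le (hh : 0 < h) (cf : Continuous f₀)
    (hS : ∀ t, HasDerivAt S (S' t) t) (hS' : ∀ t, HasDerivAt S' (S'' t) t) (cS : Continuous S'')
    (near : ∀ t ∈ Icc (m - h) m, |f₀ t + ε * S'' t - (α + β * (t - m))| ≤ B) :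
    |(∫ t in (m - h)..m, f₀ t * ((t - (m - h)) / h)) -
      (-ε * (S' m - (S m - S (m - h)) / h) + α * h / 2 - β * h ^ 2 / 6)| ≤ B * h := by
  have key := abs_integral_sub_le (F := fun t => f₀ t * ((t - (m - h)) / h))
    (P := fun t => -ε * (S' t * (t - (m - h)) / h - S t / h) +
      (α * ((t - m) ^ 2 / 2 + h * (t - m)) + β * ((t - m) ^ 3 / 3 + h * (t - m) ^ 2 / 2)) / h)
    (P' := fun t => (-ε * S'' t + (α + β * (t - m))) * ((t - (m - h)) / h))
    (a := m - h) (b := m) (B := B) (by linarith)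
    (fun t => by
      have i1 := (hasDerivAt_id t).sub_const (m - h)
      have i2 := (hasDerivAt_id t).sub_const m
      refine HasDerivAt.congr_deriv ((((((hS' t).mul i1).div_const h).sub
        ((hS t).div_const h)).const_mul (-ε)).add
        (((((i2.pow 2).div_const 2).add (i2.const_mul h)).const_mul α).add
          ((((i2.pow 3).div_const 3).add (((i2.pow 2).const_mul h).div_const 2)).const_mul β)
          |>.div_const h)) ?_
      simp
      field_simp
      ring) (by fun_prop) (by fun_prop)
    (fun t ht => by
      have hw : 0 ≤ (t - (m - h)) / h := div_nonneg (by linarith [ht.1]) hh.le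
      have hw1 : (t - (m - h)) / h ≤ 1 := (div_le_one hh).2 (by linarith [ht.2])
      have e : f₀ t * ((t - (m - h)) / h) - (-ε * S'' t + (α + β * (t - m))) * ((t - (m - h)) / h)
        = (f₀ t + ε * S'' t - (α + β * (t - m))) * ((t - (m - h)) / h) := by ring
      rw [e, abs_mul, abs_of_nonneg hw]
      exact (mul_le_of_le_one_right (abs_nonneg _) hw1).trans (near t ht))
  convert key using 2
  · congr 1
    field_simp
    ring
  · ring

/-- The load of the falling half of a hat function, for `f₀` close to `-ε S''` plus an affine
function. -/
lemma abs_integral_right_half_le (hh : 0 < h) (cf : Continuous f₀)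
    (hS : ∀ t, HasDerivAt S (S' t) t) (hS' : ∀ t, HasDerivAt S' (S'' t) t) (cS : Continuous S'')
    (near : ∀ t ∈ Icc m (m + h), |f₀ t + ε * S'' t - (α + β * (t - m))| ≤ B) :
    |(∫ t in m..(m + h), f₀ t * ((m + h - t) / h)) -
      (-ε * ((S (m + h) - S m) / h - S' m) + α * h / 2 + β * h ^ 2 / 6)| ≤ B * h := by
  have key := abs_integral_sub_le (F := fun t => f₀ t * ((m + h - t) / h))
    (P := fun t => -ε * (S' t * (m + h - t) / h + S t / h) +
      (α * (h * (t - m) - (t - m) ^ 2 / 2) + β * (h * (t - m) ^ 2 / 2 - (t - m) ^ 3 / 3)) / h)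
    (P' := fun t => (-ε * S'' t + (α + β * (t - m))) * ((m + h - t) / h))
    (a := m) (b := m + h) (B := B) (by linarith)
    (fun t => by
      have i1 := (hasDerivAt_id t).const_sub (m + h)
      have i2 := (hasDerivAt_id t).sub_const m
      refine HasDerivAt.congr_deriv ((((((hS' t).mul i1).div_const h).add
        ((hS t).div_const h)).const_mul (-ε)).add
        ((((i2.const_mul h).sub ((i2.pow 2).div_const 2)).const_mul α).add
          (((((i2.pow 2).const_mul h).div_const 2).sub ((i2.pow 3).div_const 3)).const_mul β)
          |>.div_const h)) ?_
      simp
      field_simp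
      ring) (by fun_prop) (by fun_prop)
    (fun t ht => by
      have hw : 0 ≤ (m + h - t) / h := div_nonneg (by linarith [ht.2]) hh.le
      have hw1 : (m + h - t) / h ≤ 1 := (div_le_one hh).2 (by linarith [ht.1])
      have e : f₀ t * ((m + h - t) / h) - (-ε * S'' t + (α + β * (t - m))) * ((m + h - t) / h)
        = (f₀ t + ε * S'' t - (α + β * (t - m))) * ((m + h - t) / h) := by ring
      rw [e, abs_mul, abs_of_nonneg hw]
      exact (mul_le_of_le_one_right (abs_nonneg _) hw1).trans (near t ht))
  convert key using 2
  · congr 1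
    field_simp
    ring
  · ring

end Halves

/-- The truncation error of the finite element scheme at a node is of third order, for a solution
`S` of the differential equation. The second-order part is reproduced exactly; the first-order part
needs `S''` to be Lipschitz, the zeroth-order part only needs it to be bounded. -/
lemma abs_truncation_le {ε b c h K : ℝ} {f f₀ S S' S'' : ℝ → ℝ} {j : ℕ} (hc : 0 ≤ c)
    (hK : 0 ≤ K) (hh : 0 < h)
    (hl : x (j - 1) = x j - h) (hr : x (j + 1) = x j + h) (h0 : 0 ≤ x j - h) (h1 : x j + h ≤ 1)
    (hf : ∀ t ∈ Icc (0 : ℝ) 1, f t = f₀ t) (cf : Continuous f₀)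
    (hS : ∀ t, HasDerivAt S (S' t) t) (hS' : ∀ t, HasDerivAt S' (S'' t) t) (cS : Continuous S'')
    (eq : ∀ t ∈ Icc (0 : ℝ) 1, -ε * S'' t - b * S' t + c * S t = f₀ t)
    (bS : ∀ t ∈ Icc (0 : ℝ) 1, |S'' t| ≤ K)
    (lS : ∀ s ∈ Icc (0 : ℝ) 1, ∀ t ∈ Icc (0 : ℝ) 1, |b| * |S'' t - S'' s| ≤ K * |t - s|) :
    |l2 f (nodal x j) - (lowerCoeff ε b c h * S (x (j - 1)) + diagCoeff ε c h * S (x j) +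
      upperCoeff ε b c h * S (x (j + 1)))| ≤ 3 * (1 + c) * K * h ^ 3 := by
  rw [l2_nodal hh hl hr h0 h1 hf cf, hl, hr]
  generalize x j = m at *
  have sub : ∀ t ∈ Icc (m - h) (m + h), t ∈ Icc (0 : ℝ) 1 :=
    fun t ht => ⟨h0.trans ht.1, ht.2.trans h1⟩
  have hmm : m ∈ Icc (m - h) (m + h) := ⟨by linarith, by linarith⟩
  have hml : m - h ∈ Icc (m - h) (m + h) := ⟨by linarith, by linarith⟩
  have hmr : m + h ∈ Icc (m - h) (m + h) := ⟨by linarith, by linarith⟩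
  have hKh : 0 ≤ K * h := by positivity
  have T0 : ∀ t ∈ Icc (m - h) (m + h), |S' t - S' m| ≤ K * h := fun t ht =>
    abs_sub_le_of_abs_deriv_le hh.le hK hS' (fun s hs => bS s (sub s hs)) ht
  have T1 : ∀ t ∈ Icc (m - h) (m + h), |S t - S m - (t - m) * S' m| ≤ K * h * h := fun t ht =>
    abs_taylor_one_le hh.le hKh hS T0 ht
  have T2 : ∀ t ∈ Icc (m - h) (m + h),
      |b * S' t - b * S' m - (t - m) * (b * S'' m)| ≤ K * h * h := fun t ht =>
    abs_taylor_one_le (F := fun t => b * S' t) (F' := fun t => b * S'' t) hh.le hKh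
      (fun t => (hS' t).const_mul b) (fun s hs => by
        rw [← mul_sub, abs_mul]
        refine (lS m (sub m hmm) s (sub s hs)).trans (mul_le_mul_of_nonneg_left ?_ hK)
        exact abs_le.2 ⟨by linarith [hs.1], by linarith [hs.2]⟩) ht
  have T3 : ∀ t ∈ Icc (m - h) (m + h),
      |b * (S t - (t - m) ^ 2 / 2 * S'' m) - b * (S m - (m - m) ^ 2 / 2 * S'' m) -
        (t - m) * (b * (S' m - (m - m) * S'' m))| ≤ K * h * h * h := fun t ht =>
    abs_taylor_one_le (F := fun t => b * (S t - (t - m) ^ 2 / 2 * S'' m))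
      (F' := fun t => b * (S' t - (t - m) * S'' m)) hh.le (by positivity)
      (fun t => by
        have h := (hasDerivAt_id t).sub_const m
        refine (((hS t).sub (((h.pow 2).div_const 2).mul_const (S'' m))).const_mul b).congr_deriv ?_
        simp)
      (fun s hs => by
        have := T2 s hs
        convert this using 2
        ring) ht
  -- The lower-order terms of `f₀` are replaced by their first-order Taylor polynomial at `m`.
  set α := -b * S' m + c * S m with hα
  set β := -b * S'' m + c * S' m with hβ
  have near : ∀ t ∈ Icc (m - h) (m + h),
      |f₀ t + ε * S'' t - (α + β * (t - m))| ≤ (1 + c) * K * h ^ 2 := by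
    intro t ht
    have e : f₀ t + ε * S'' t - (α + β * (t - m)) =
        -(b * S' t - b * S' m - (t - m) * (b * S'' m)) + c * (S t - S m - (t - m) * S' m) := by
      rw [← eq t (sub t ht), hα, hβ]
      ring
    rw [e]
    refine (abs_add_le _ _).trans ?_
    rw [abs_neg, abs_mul, abs_of_nonneg hc]
    have h1 := T2 t ht
    have h2 := mul_le_mul_of_nonneg_left (T1 t ht) hc
    linarith
  have L := abs_integral_left_half_le hh cf hS hS' cS
    (fun t ht => near t ⟨ht.1, ht.2.trans hmm.2⟩)
  have R := abs_integral_right_half_le hh cf hS hS' cS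
    (fun t ht => near t ⟨hmm.1.trans ht.1, ht.2⟩)
  have Ar := T3 _ hmr
  have Al := T3 _ hml
  have Br := mul_le_mul_of_nonneg_left (T1 _ hmr) (by positivity : 0 ≤ c * h)
  have Bl := mul_le_mul_of_nonneg_left (T1 _ hml) (by positivity : 0 ≤ c * h)
  have hc3 : 0 ≤ c * K * h ^ 3 := by positivity
  generalize (∫ t in (m - h)..m, f₀ t * ((t - (m - h)) / h)) = I at L ⊢
  generalize (∫ t in m..(m + h), f₀ t * ((m + h - t) / h)) = J at R ⊢
  clear T0 T1 T2 T3 near bS lS eq sub hmm hml hmr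
  set D := I - (-ε * (S' m - (S m - S (m - h)) / h) + α * h / 2 - β * h ^ 2 / 6) with hD
  set D' := J - (-ε * ((S (m + h) - S m) / h - S' m) + α * h / 2 + β * h ^ 2 / 6) with hD'
  set X := b * (S (m + h) - (m + h - m) ^ 2 / 2 * S'' m) - b * (S m - (m - m) ^ 2 / 2 * S'' m) -
        (m + h - m) * (b * (S' m - (m - m) * S'' m)) with hX
  set Y := b * (S (m - h) - (m - h - m) ^ 2 / 2 * S'' m) - b * (S m - (m - m) ^ 2 / 2 * S'' m) -
        (m - h - m) * (b * (S' m - (m - m) * S'' m)) with hY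
  set Z := S (m + h) - S m - (m + h - m) * S' m with hZ
  set W := S (m - h) - S m - (m - h - m) * S' m with hW
  have e : I + J - (lowerCoeff ε b c h * S (m - h) + diagCoeff ε c h * S m +
      upperCoeff ε b c h * S (m + h)) =
      D + D' + X / 2 - Y / 2 - c * h * Z / 6 - c * h * W / 6 := by
    rw [hD, hD', hX, hY, hZ, hW, hα, hβ]
    unfold lowerCoeff diagCoeff upperCoeff
    ring
  rw [e]
  have Br' : |c * h * Z| ≤ c * h * (K * h * h) := by
    rwa [abs_mul, abs_of_nonneg (by positivity : 0 ≤ c * h)]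
  have Bl' : |c * h * W| ≤ c * h * (K * h * h) := by
    rwa [abs_mul, abs_of_nonneg (by positivity : 0 ≤ c * h)]
  clear_value D D' X Y Z W
  rw [abs_le] at L R Ar Al Br' Bl' ⊢
  constructor <;> linarith

end SPFem

/-! ### The regular part of the solution -/

lemma exists_extension_of_contDiffOn_two {f : ℝ → ℝ} (hf : ContDiffOn ℝ 2 f (Icc 0 1)) :
    ∃ F F' F'' : ℝ → ℝ, (∀ t, HasDerivAt F (F' t) t) ∧ (∀ t, HasDerivAt F' (F'' t) t) ∧
      Continuous F'' ∧ ∀ t ∈ Icc (0 : ℝ) 1, f t = F t := by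
  have hu : UniqueDiffOn ℝ (Icc (0 : ℝ) 1) := uniqueDiffOn_Icc zero_lt_one
  set g₁ := derivWithin f (Icc 0 1) with hg₁
  set g₂ := derivWithin g₁ (Icc 0 1) with hg₂
  have c1 : ContDiffOn ℝ 1 g₁ (Icc 0 1) := hf.derivWithin hu (by norm_num)
  have c2 : ContDiffOn ℝ 0 g₂ (Icc 0 1) := c1.derivWithin hu (by norm_num)
  set F'' : ℝ → ℝ := IccExtend zero_le_one ((Icc (0 : ℝ) 1).domRestrict g₂)
  have cF'' : Continuous F'' := c2.continuousOn.domRestrict.Icc_extend'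
  have eF'' : ∀ t ∈ Icc (0 : ℝ) 1, F'' t = g₂ t := fun t ht => IccExtend_of_mem _ _ ht
  set F' : ℝ → ℝ := fun t => g₁ 0 + ∫ s in (0 : ℝ)..t, F'' s
  have dF' : ∀ t, HasDerivAt F' (F'' t) t := fun t =>
    (intervalIntegral.integral_hasDerivAt_right (cF''.intervalIntegrable _ _)
      (cF''.stronglyMeasurableAtFilter _ _) cF''.continuousAt).const_add _
  have cF' : Continuous F' := continuous_iff_continuousAt.2 fun t => (dF' t).continuousAt
  set F : ℝ → ℝ := fun t => f 0 + ∫ s in (0 : ℝ)..t, F' s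
  have dF : ∀ t, HasDerivAt F (F' t) t := fun t =>
    (intervalIntegral.integral_hasDerivAt_right (cF'.intervalIntegrable _ _)
      (cF'.stronglyMeasurableAtFilter _ _) cF'.continuousAt).const_add _
  have e1 : ∀ t ∈ Icc (0 : ℝ) 1, g₁ t = F' t := by
    refine eq_of_derivWithin_eq (c1.differentiableOn (by norm_num))
      (fun t _ => (dF' t).differentiableAt.differentiableWithinAt) (fun t ht => ?_) (by simp [F'])
    have ht' := Ico_subset_Icc_self ht
    rw [(dF' t).hasDerivWithinAt.derivWithin (hu t ht'), eF'' t ht']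
  refine ⟨F, F', F'', dF, dF', cF'', ?_⟩
  refine eq_of_derivWithin_eq (hf.differentiableOn (by norm_num))
      (fun t _ => (dF t).differentiableAt.differentiableWithinAt) (fun t ht => ?_) (by simp [F])
  have ht' := Ico_subset_Icc_self ht
  rw [(dF t).hasDerivWithinAt.derivWithin (hu t ht'), ← e1 t ht']

/-- The solution of `R' = -ρ R + g`, `R 0 = 0`, for a nonnegative damping rate `ρ`. -/
lemma exists_damped_primitive {ρ M : ℝ} {g : ℝ → ℝ} (hρ : 0 ≤ ρ) (cg : Continuous g)
    (hg : ∀ t ∈ Icc (0 : ℝ) 1, |g t| ≤ M) :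
    ∃ R : ℝ → ℝ, (∀ t, HasDerivAt R (-ρ * R t + g t) t) ∧ R 0 = 0 ∧
      ∀ t ∈ Icc (0 : ℝ) 1, |R t| ≤ M ∧ ρ * |R t| ≤ M := by
  have hM : 0 ≤ M := (abs_nonneg _).trans (hg 0 ⟨le_rfl, zero_le_one⟩)
  have ck : Continuous fun s => Real.exp (ρ * s) * g s := by fun_prop
  have dE : ∀ t, HasDerivAt (fun s => Real.exp (ρ * s)) (ρ * Real.exp (ρ * t)) t := fun t => by
    have := ((hasDerivAt_id t).const_mul ρ).exp
    simpa [mul_comm] using this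
  refine ⟨fun t => Real.exp (-ρ * t) * ∫ s in (0 : ℝ)..t, Real.exp (ρ * s) * g s, fun t => ?_,
    by simp, fun t ht => ?_⟩
  · have h1 : HasDerivAt (fun s => Real.exp (-ρ * s)) (-ρ * Real.exp (-ρ * t)) t := by
      have := ((hasDerivAt_id t).const_mul (-ρ)).exp
      simpa [mul_comm] using this
    have h2 := intervalIntegral.integral_hasDerivAt_right (ck.intervalIntegrable 0 t)
      (ck.stronglyMeasurableAtFilter _ _) ck.continuousAt
    refine (h1.mul h2).congr_deriv ?_
    have h3 : Real.exp (-ρ * t) * Real.exp (ρ * t) = 1 := by rw [← Real.exp_add]; simp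
    linear_combination g t * h3
  · have h3 : Real.exp (-ρ * t) * Real.exp (ρ * t) = 1 := by rw [← Real.exp_add]; simp
    have habs : ∀ B, |∫ s in (0 : ℝ)..t, Real.exp (ρ * s) * g s| ≤ B * Real.exp (ρ * t) →
        |Real.exp (-ρ * t) * ∫ s in (0 : ℝ)..t, Real.exp (ρ * s) * g s| ≤ B := fun B hB => by
      rw [abs_mul, abs_of_pos (Real.exp_pos _)]
      calc _ ≤ Real.exp (-ρ * t) * (B * Real.exp (ρ * t)) := by gcongr
        _ = B := by linear_combination B * h3
    have hb : ∀ s ∈ Ioc 0 t, |Real.exp (ρ * s) * g s| ≤ M * Real.exp (ρ * s) := fun s hs => by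
      rw [abs_mul, abs_of_pos (Real.exp_pos _), mul_comm]
      have := hg s ⟨hs.1.le, hs.2.trans ht.2⟩
      gcongr
    constructor
    · refine habs M ?_
      have := intervalIntegral.norm_integral_le_of_norm_le_const (a := 0) (b := t)
        (C := M * Real.exp (ρ * t)) (f := fun s => Real.exp (ρ * s) * g s) fun s hs => by
          rw [uIoc_of_le ht.1] at hs
          refine (hb s hs).trans ?_
          have := hs.2
          gcongr
      refine this.trans ?_
      rw [sub_zero, abs_of_nonneg ht.1]
      exact mul_le_of_le_one_right (by positivity) ht.2
    · rcases hρ.eq_or_lt with rfl | hρ'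
      · simpa using hM
      rw [mul_comm, ← le_div_iff₀ hρ']
      refine habs _ ?_
      have h4 := intervalIntegral.norm_integral_le_of_norm_le ht.1 (μ := volume)
        (f := fun s => Real.exp (ρ * s) * g s) (g := fun s => M * Real.exp (ρ * s))
        (Filter.Eventually.of_forall hb)
        ((by fun_prop : Continuous _).intervalIntegrable _ _)
      refine h4.trans ?_
      rw [intervalIntegral.integral_eq_sub_of_hasDerivAt
        (f := fun s => M / ρ * Real.exp (ρ * s))
        (fun s _ => ((dE s).const_mul (M / ρ)).congr_deriv (by field_simp))
        ((by fun_prop : Continuous _).intervalIntegrable _ _)]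
      have : 0 ≤ M / ρ := by positivity
      simpa using this

/-- The solution of `G' = ρ G - g`, `G 1 = 0`, which is stable towards the left. -/
lemma exists_backward_damped_primitive {ρ M : ℝ} {g : ℝ → ℝ} (hρ : 0 ≤ ρ) (cg : Continuous g)
    (hg : ∀ t ∈ Icc (0 : ℝ) 1, |g t| ≤ M) :
    ∃ G : ℝ → ℝ, (∀ t, HasDerivAt G (ρ * G t - g t) t) ∧
      ∀ t ∈ Icc (0 : ℝ) 1, |G t| ≤ M ∧ ρ * |G t| ≤ M := by
  obtain ⟨R, hR, _, bR⟩ := exists_damped_primitive (g := fun t => g (1 - t)) hρ (by fun_prop)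
    (fun t ht => hg (1 - t) ⟨by linarith [ht.2], by linarith [ht.1]⟩)
  refine ⟨fun t => R (1 - t), fun t => ?_,
    fun t ht => bR (1 - t) ⟨by linarith [ht.2], by linarith [ht.1]⟩⟩
  have := (hR (1 - t)).comp t ((hasDerivAt_id t).const_sub 1)
  refine this.congr_deriv ?_
  simp only [sub_sub_cancel]
  ring

namespace SPFem

/-- `S`, with derivatives `S'` and `S''`, solves `-ε S'' - b S' + c S = F`, and it has no layer, in
the sense that `K` bounds the boundary values of `S`, its second derivative and, up to the factor
`b`, the Lipschitz constant of the second derivative. No boundary condition is imposed. -/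
structure IsRegularPart (ε b c K : ℝ) (F S S' S'' : ℝ → ℝ) : Prop where
  hasDerivAt : ∀ t, HasDerivAt S (S' t) t
  hasDerivAt' : ∀ t, HasDerivAt S' (S'' t) t
  continuous : Continuous S''
  equation : ∀ t, -ε * S'' t - b * S' t + c * S t = F t
  abs_zero_le : |S 0| ≤ K
  abs_one_le : |S 1| ≤ K
  abs_le : ∀ t ∈ Icc (0 : ℝ) 1, |S'' t| ≤ K
  lipschitz : ∀ s ∈ Icc (0 : ℝ) 1, ∀ t ∈ Icc (0 : ℝ) 1, |b| * |S'' t - S'' s| ≤ K * |t - s|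

/-- The nonpositive root of `ε r² + b r - c = 0`. -/
noncomputable def decayRate (ε b c : ℝ) : ℝ := (-b - Real.sqrt (b ^ 2 + 4 * ε * c)) / (2 * ε)

section Roots

variable {ε b c : ℝ}

lemma layerRate_add_decayRate (hε : 0 < ε) : ε * (layerRate ε b c + decayRate ε b c) = -b := by
  unfold layerRate decayRate
  field_simp
  ring

lemma layerRate_mul_decayRate (hε : 0 < ε) (hc : 0 ≤ c) :
    ε * (layerRate ε b c * decayRate ε b c) = -c := by
  have h := Real.sq_sqrt (by positivity : 0 ≤ b ^ 2 + 4 * ε * c)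
  unfold layerRate decayRate
  generalize Real.sqrt (b ^ 2 + 4 * ε * c) = w at h ⊢
  field_simp
  linear_combination -h

lemma neg_le_mul_layerRate (hε : 0 < ε) (hc : 0 ≤ c) : -b ≤ ε * layerRate ε b c := by
  have h : |b| ≤ Real.sqrt (b ^ 2 + 4 * ε * c) := by
    rw [← Real.sqrt_sq_eq_abs]
    exact Real.sqrt_le_sqrt (by nlinarith [mul_nonneg hε.le hc])
  have h3 : ε * layerRate ε b c = (-b + Real.sqrt (b ^ 2 + 4 * ε * c)) / 2 := by
    unfold layerRate; field_simp
  rw [h3]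
  linarith [neg_le_abs b]

lemma layerRate_nonneg (hε : 0 < ε) (hb : b ≤ 0) : 0 ≤ layerRate ε b c := by
  have := Real.sqrt_nonneg (b ^ 2 + 4 * ε * c)
  exact div_nonneg (by linarith) (by linarith)

lemma decayRate_nonpos (hε : 0 < ε) (hc : 0 ≤ c) : decayRate ε b c ≤ 0 := by
  have h : |b| ≤ Real.sqrt (b ^ 2 + 4 * ε * c) := by
    rw [← Real.sqrt_sq_eq_abs]
    exact Real.sqrt_le_sqrt (by nlinarith [mul_nonneg hε.le hc])
  exact div_nonpos_of_nonpos_of_nonneg (by linarith [neg_le_abs b]) (by linarith)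

/-- The two exponential rates stay apart uniformly in `ε ≤ 1`. -/
lemma sqrt_le_layerRate_sub_decayRate (hε : 0 < ε) (hε1 : ε ≤ 1) (hc : 0 ≤ c) :
    Real.sqrt (b ^ 2 + 4 * c) ≤ layerRate ε b c - decayRate ε b c := by
  have h : layerRate ε b c - decayRate ε b c = Real.sqrt (b ^ 2 + 4 * ε * c) / ε := by
    unfold layerRate decayRate
    field_simp
    ring
  rw [h, le_div_iff₀ hε]
  refine Real.le_sqrt_of_sq_le ?_
  rw [mul_pow, Real.sq_sqrt (by positivity)]
  have : ε ^ 2 ≤ 1 := by nlinarith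
  nlinarith [mul_nonneg (sq_nonneg b) (sub_nonneg.2 this),
    mul_nonneg (mul_nonneg hc hε.le) (sub_nonneg.2 hε1)]

end Roots

section RegularPart

variable {b c M : ℝ} {F F' F'' : ℝ → ℝ}

/-- The regular part for `b < 0`. In the factorisation `-ε (D - r₁) (D - r₂)` of the operator, with
`r₁ > 0 ≥ r₂`, the factor `D - r₁` is inverted from the right, starting from a value at `1` that
creates no layer, and `D - r₂` from the left. -/
lemma exists_isRegularPart_of_neg (hb : b < 0) (hc : 0 ≤ c) (hF : ∀ t, HasDerivAt F (F' t) t)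
    (hF' : ∀ t, HasDerivAt F' (F'' t) t) (cF : Continuous F'')
    (bF : ∀ t ∈ Icc (0 : ℝ) 1, |F t| ≤ M ∧ |F' t| ≤ M ∧ |F'' t| ≤ M) :
    ∃ K, ∀ ε, 0 < ε → ε ≤ 1 → ∃ S S' S'', IsRegularPart ε b c K F S S' S'' ∧ S 0 = 0 := by
  have hM : 0 ≤ M := (abs_nonneg _).trans (bF 0 ⟨le_rfl, zero_le_one⟩).1
  obtain ⟨β, rfl⟩ : ∃ β, b = -β := ⟨-b, by ring⟩
  have hβ : 0 < β := by linarith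
  -- Bounds for `V`, `S''` and `S'''`, where `V = S' - r₂ S`.
  obtain ⟨BV, hBV⟩ : ∃ B, B = M / β + M / β ^ 2 + M / β ^ 2 := ⟨_, rfl⟩
  have hBV0 : 0 ≤ BV := by rw [hBV]; positivity
  obtain ⟨K₂, hK₂⟩ : ∃ B, B = c / β * ((c / β) * BV + BV) + 2 * M / β := ⟨_, rfl⟩
  have hK₂0 : 0 ≤ K₂ := by rw [hK₂]; positivity
  obtain ⟨K₃, hK₃⟩ : ∃ B, B = c / β * K₂ + M / β := ⟨_, rfl⟩
  have hK₃0 : 0 ≤ K₃ := by rw [hK₃]; positivity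
  refine ⟨BV + K₂ + β * K₃, fun ε hε hε1 => ?_⟩
  have hsum := layerRate_add_decayRate (b := -β) (c := c) hε
  have hprod := layerRate_mul_decayRate (b := -β) hε hc
  have hr1 := neg_le_mul_layerRate (b := -β) hε hc
  have hr2 := decayRate_nonpos (b := -β) hε hc
  generalize layerRate ε (-β) c = r₁ at *
  generalize decayRate ε (-β) c = r₂ at *
  rw [neg_neg] at hsum hr1
  have hr1pos : 0 < r₁ := by
    by_contra h
    nlinarith
  have hr1β : β ≤ r₁ := by nlinarith
  have hr2c : -r₂ ≤ c / β := by
    rw [le_div_iff₀ hβ]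
    nlinarith
  obtain ⟨G, hG, bG⟩ := exists_backward_damped_primitive hr1pos.le cF (fun t ht => (bF t ht).2.2)
  have cont : ∀ {g g' : ℝ → ℝ}, (∀ t, HasDerivAt g (g' t) t) → Continuous g := fun h =>
    continuous_iff_continuousAt.2 fun t => (h t).continuousAt
  have cG := cont hG
  have cF0 := cont hF
  have cF1 := cont hF'
  set V : ℝ → ℝ := fun t => F t / (ε * r₁) + F' t / (ε * r₁ ^ 2) + G t / (ε * r₁ ^ 2) with hV
  set V' : ℝ → ℝ := fun t => (F' t + G t) / (ε * r₁) with hV'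
  have dV : ∀ t, HasDerivAt V (V' t) t := fun t => by
    refine ((((hF t).div_const _).add ((hF' t).div_const _)).add
      ((hG t).div_const _)).congr_deriv ?_
    simp only [hV']
    field_simp
    ring
  have dV' : ∀ t, HasDerivAt V' (G t / ε) t := fun t => by
    refine (((hF' t).add (hG t)).div_const _).congr_deriv ?_
    field_simp
    ring
  have h2 : β ^ 2 ≤ ε * r₁ ^ 2 := by nlinarith
  have bV : ∀ t ∈ Icc (0 : ℝ) 1, |V t| ≤ BV := fun t ht => by
    obtain ⟨b0, b1, b2⟩ := bF t ht
    have b3 := (bG t ht).1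
    refine (abs_add_three _ _ _).trans ?_
    rw [abs_div, abs_div, abs_div, abs_of_pos (by positivity : 0 < ε * r₁),
      abs_of_pos (by positivity : 0 < ε * r₁ ^ 2), hBV]
    gcongr
  have bV' : ∀ t ∈ Icc (0 : ℝ) 1, |V' t| ≤ 2 * M / β := fun t ht => by
    simp only [hV']
    rw [abs_div, abs_of_pos (by positivity : 0 < ε * r₁)]
    have := (abs_add_le (F' t) (G t)).trans (add_le_add (bF t ht).2.1 (bG t ht).1)
    gcongr
    linarith
  have bG' : ∀ t ∈ Icc (0 : ℝ) 1, |G t / ε| ≤ M / β := fun t ht => by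
    rw [abs_div, abs_of_pos hε, div_le_div_iff₀ hε hβ]
    have := (bG t ht).2
    nlinarith [abs_nonneg (G t)]
  obtain ⟨S, hS, S0, bS⟩ := exists_damped_primitive (neg_nonneg.2 hr2) (cont dV) bV
  simp only [neg_neg] at hS
  have dS1 : ∀ t, HasDerivAt (fun t => r₂ * S t + V t) (r₂ * (r₂ * S t + V t) + V' t) t :=
    fun t => ((hS t).const_mul r₂).add (dV t)
  have dS2 : ∀ t, HasDerivAt (fun t => r₂ * (r₂ * S t + V t) + V' t)
      (r₂ * (r₂ * (r₂ * S t + V t) + V' t) + G t / ε) t :=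
    fun t => ((dS1 t).const_mul r₂).add (dV' t)
  have step : ∀ {p q B B' : ℝ}, |p| ≤ B → |q| ≤ B' → |r₂ * p + q| ≤ c / β * B + B' := by
    intro p q B B' hp hq
    refine (abs_add_le _ _).trans (add_le_add ?_ hq)
    rw [abs_mul, abs_of_nonpos hr2]
    gcongr
  have b2 : ∀ t ∈ Icc (0 : ℝ) 1, |r₂ * (r₂ * S t + V t) + V' t| ≤ K₂ := fun t ht =>
    hK₂ ▸ step (step (bS t ht).1 (bV t ht)) (bV' t ht)
  refine ⟨S, _, _, ⟨hS, dS1, cont dS2, fun t => ?_, ?_, ?_, fun t ht => ?_,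
    fun s hs t ht => ?_⟩, S0⟩
  · have hne : ε * r₁ ≠ 0 := by positivity
    have e1 : -ε * (V' t - r₁ * V t) = F t := by
      simp only [hV, hV']
      field_simp
      ring
    linear_combination e1 - V t * hsum - r₂ * S t * hsum + S t * hprod
  · rw [S0, abs_zero]
    positivity
  · have := (bS 1 ⟨zero_le_one, le_rfl⟩).1
    nlinarith [mul_nonneg hβ.le hK₃0]
  · have := b2 t ht
    nlinarith [mul_nonneg hβ.le hK₃0]
  · have := Convex.norm_image_sub_le_of_norm_hasDerivWithin_le (C := K₃)
      (fun x _ => (dS2 x).hasDerivWithinAt)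
      (fun x hx => hK₃ ▸ step (b2 x hx) (bG' x hx)) (convex_Icc (0 : ℝ) 1) hs ht
    rw [Real.norm_eq_abs, Real.norm_eq_abs] at this
    rw [abs_neg, abs_of_pos hβ]
    calc _ ≤ β * (K₃ * |t - s|) := by gcongr
      _ ≤ _ := by nlinarith [mul_nonneg (add_nonneg hBV0 hK₂0) (abs_nonneg (t - s))]

/-- The regular part for `b = 0` is a perturbation of the reduced solution `F / c`, and agrees with
it at `0`. -/
lemma exists_isRegularPart_of_eq_zero (hc : 0 < c) (hF : ∀ t, HasDerivAt F (F' t) t)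
    (hF' : ∀ t, HasDerivAt F' (F'' t) t) (cF : Continuous F'')
    (bF : ∀ t ∈ Icc (0 : ℝ) 1, |F t| ≤ M ∧ |F' t| ≤ M ∧ |F'' t| ≤ M) :
    ∃ K, ∀ ε, 0 < ε → ε ≤ 1 → ∃ S S' S'', IsRegularPart ε 0 c K F S S' S'' ∧ S 0 = F 0 / c := by
  have hM : 0 ≤ M := (abs_nonneg _).trans (bF 0 ⟨le_rfl, zero_le_one⟩).1
  refine ⟨M / c + M / c ^ 2, fun ε hε hε1 => ?_⟩
  set r := Real.sqrt (c / ε)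
  have hr : 0 < r := Real.sqrt_pos.2 (by positivity)
  have hr2 : ε * r ^ 2 = c := by
    rw [Real.sq_sqrt (by positivity)]
    field_simp
  obtain ⟨G, hG, bG⟩ := exists_backward_damped_primitive hr.le cF (fun t ht => (bF t ht).2.2)
  have cG : Continuous G := continuous_iff_continuousAt.2 fun t => (hG t).continuousAt
  have bG1 : ∀ t ∈ Icc (0 : ℝ) 1, |r * G t / c| ≤ M / c := fun t ht => by
    rw [abs_div, abs_of_pos hc, abs_mul, abs_of_pos hr]
    have := (bG t ht).2
    gcongr
  obtain ⟨Q, hQ, Q0, bQ⟩ := exists_damped_primitive (g := fun t => r * G t / c) hr.le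
    (by fun_prop) bG1
  have bQ' : ∀ t ∈ Icc (0 : ℝ) 1, |r * Q t| ≤ M / c := fun t ht => by
    rw [abs_mul, abs_of_pos hr]
    exact (bQ t ht).2
  have hMc : 0 ≤ M / c := by positivity
  have hMc2 : 0 ≤ M / c ^ 2 := by positivity
  have cQ : Continuous Q := continuous_iff_continuousAt.2 fun t => (hQ t).continuousAt
  refine ⟨fun t => F t / c + Q t / r, fun t => F' t / c + (-Q t + G t / c), fun t => r * Q t,
    ⟨fun t => ?_, fun t => ?_, by fun_prop, fun t => ?_, ?_, ?_, fun t ht => ?_,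
    fun s _ t _ => ?_⟩, by simp [Q0]⟩
  · refine (((hF t).div_const c).add ((hQ t).div_const r)).congr_deriv ?_
    field_simp
  · refine (((hF' t).div_const c).add ((hQ t).neg.add ((hG t).div_const c))).congr_deriv ?_
    field_simp
    ring
  · have e : c * (Q t / r) = ε * r * Q t := by
      rw [← hr2]
      field_simp
    have e' : c * (F t / c) = F t := by field_simp
    linear_combination e + e'
  · rw [Q0, zero_div, add_zero, abs_div, abs_of_pos hc]
    have := (bF 0 ⟨le_rfl, zero_le_one⟩).1
    have : |F 0| / c ≤ M / c := by gcongr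
    linarith
  · have h1 : (1 : ℝ) ∈ Icc (0 : ℝ) 1 := ⟨zero_le_one, le_rfl⟩
    refine (abs_add_le _ _).trans (add_le_add ?_ ?_)
    · rw [abs_div, abs_of_pos hc]
      have := (bF 1 h1).1
      gcongr
    · have e : Q 1 / r = r * Q 1 * (ε / c) := by
        rw [← hr2]
        field_simp
      rw [e, abs_mul, abs_of_pos (by positivity : 0 < ε / c)]
      calc _ ≤ M / c * (1 / c) := by
            have := bQ' 1 h1
            gcongr
        _ = M / c ^ 2 := by ring
  · have := bQ' t ht
    linarith
  · rw [abs_zero, zero_mul]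
    positivity

end RegularPart

end SPFem

/-! ### The weak solution -/

namespace SPFem

/-- A classical solution is the weak one, by coercivity of the bilinear form. -/
lemma IsWeakSolution.eq_of_hasDerivAt {ε b c : ℝ} {f u w w' w'' : ℝ → ℝ} (hε : 0 < ε) (hc : 0 ≤ c)
    (hu : IsWeakSolution ε b c f u) (hw : ∀ t, HasDerivAt w (w' t) t)
    (hw' : ∀ t, HasDerivAt w' (w'' t) t) (cw : Continuous w'') (w0 : w 0 = 0) (w1 : w 1 = 0)
    (eq : ∀ t ∈ Icc (0 : ℝ) 1, -ε * w'' t - b * w' t + c * w t = f t) :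
    ∀ t ∈ Icc (0 : ℝ) 1, u t = w t := by
  have dw : deriv w = w' := funext fun t => (hw t).deriv
  have dw' : deriv w' = w'' := funext fun t => (hw' t).deriv
  have cw' : Continuous w' := continuous_iff_continuousAt.2 fun t => (hw' t).continuousAt
  have cw0 : Continuous w := continuous_iff_continuousAt.2 fun t => (hw t).continuousAt
  have ac : AbsolutelyContinuousOnInterval w 0 1 :=
    (contDiff_one_iff_deriv.2 ⟨fun t => (hw t).differentiableAt,
      by rwa [dw]⟩).contDiffOn.absolutelyContinuousOnInterval
  have ac' : AbsolutelyContinuousOnInterval w' 0 1 :=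
    (contDiff_one_iff_deriv.2 ⟨fun t => (hw' t).differentiableAt,
      by rwa [dw']⟩).contDiffOn.absolutelyContinuousOnInterval
  obtain ⟨⟨acu, Lu, u0, u1⟩, hform⟩ := hu
  set v := u - w with hv
  have acv : AbsolutelyContinuousOnInterval v 0 1 := acu.sub ac
  have v0 : v 0 = 0 := by simp [hv, u0, w0]
  have v1 : v 1 = 0 := by simp [hv, u1, w1]
  have aed : ∀ᵐ t : ℝ, t ∈ Icc (0 : ℝ) 1 → deriv u t = deriv v t + w' t := by
    filter_upwards [acu.ae_differentiableAt] with t ht hmem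
    rw [uIcc_of_le zero_le_one] at ht
    rw [hv, deriv_sub (ht hmem) (hw t).differentiableAt, dw]
    ring
  have Lw : MemLp w' 2 (volume.restrict (Ioo (0 : ℝ) 1)) := by
    obtain ⟨B, hB⟩ := (isCompact_Icc (a := (0 : ℝ)) (b := 1)).exists_bound_of_continuousOn
      cw'.continuousOn
    refine MemLp.of_bound cw'.aestronglyMeasurable B ?_
    filter_upwards [ae_restrict_mem measurableSet_Ioo] with t ht
    exact hB t (Ioo_subset_Icc_self ht)
  have Lv : MemLp (deriv v) 2 (volume.restrict (Ioo (0 : ℝ) 1)) := by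
    refine (memLp_congr_ae ?_).2 (Lu.sub Lw)
    filter_upwards [ae_restrict_mem measurableSet_Ioo, ae_restrict_of_ae aed] with t ht h
    simp [h (Ioo_subset_Icc_self ht)]
  have hvt := hform v ⟨acv, Lv, v0, v1⟩
  have cv : ContinuousOn v (uIcc 0 1) := acv.continuousOn
  have iv := acv.intervalIntegrable_deriv
  have ivv : IntervalIntegrable (fun t => deriv v t * deriv v t) volume 0 1 := by
    rw [intervalIntegrable_iff_integrableOn_Ioo_of_le zero_le_one]
    have := Lv.integrable_sq
    simp only [sq] at this
    exact this
  have e1 : l2 (deriv u) (deriv v) =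
      (∫ t in (0 : ℝ)..1, deriv v t * deriv v t) + ∫ t in (0 : ℝ)..1, w' t * deriv v t := by
    unfold l2
    rw [← intervalIntegral.integral_add ivv (iv.continuousOn_mul cw'.continuousOn)]
    refine intervalIntegral.integral_congr_ae ?_
    filter_upwards [aed] with t ht hmem
    rw [uIoc_of_le zero_le_one] at hmem
    rw [ht (Ioc_subset_Icc_self hmem)]
    ring
  have e2 : l2 u (deriv v) =
      (∫ t in (0 : ℝ)..1, v t * deriv v t) + ∫ t in (0 : ℝ)..1, w t * deriv v t := by
    unfold l2
    rw [← intervalIntegral.integral_add (iv.continuousOn_mul cv)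
      (iv.continuousOn_mul cw0.continuousOn)]
    refine intervalIntegral.integral_congr fun t _ => ?_
    simp only [hv, Pi.sub_apply]
    ring
  have i00 : IntervalIntegrable (fun t => v t * v t) volume 0 1 := (cv.mul cv).intervalIntegrable
  have i0 : IntervalIntegrable (fun t => w t * v t) volume 0 1 :=
    (cw0.continuousOn.mul cv).intervalIntegrable
  have e3 : l2 u v = (∫ t in (0 : ℝ)..1, v t * v t) + ∫ t in (0 : ℝ)..1, w t * v t := by
    unfold l2
    rw [← intervalIntegral.integral_add i00 i0]
    refine intervalIntegral.integral_congr fun t _ => ?_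
    simp only [hv, Pi.sub_apply]
    ring
  have i1 : IntervalIntegrable (fun t => w' t * v t) volume 0 1 :=
    (cw'.continuousOn.mul cv).intervalIntegrable
  have i2 : IntervalIntegrable (fun t => w'' t * v t) volume 0 1 :=
    (cw.continuousOn.mul cv).intervalIntegrable
  have e4 : l2 f v = -ε * (∫ t in (0 : ℝ)..1, w'' t * v t) - b * (∫ t in (0 : ℝ)..1, w' t * v t) +
      c * ∫ t in (0 : ℝ)..1, w t * v t := by
    unfold l2
    rw [← intervalIntegral.integral_const_mul, ← intervalIntegral.integral_const_mul,
      ← intervalIntegral.integral_const_mul,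
      ← intervalIntegral.integral_sub (i2.const_mul _) (i1.const_mul _),
      ← intervalIntegral.integral_add ((i2.const_mul _).sub (i1.const_mul _)) (i0.const_mul _)]
    refine intervalIntegral.integral_congr fun t ht => ?_
    rw [uIcc_of_le zero_le_one] at ht
    rw [← eq t ht]
    ring
  have p1 := acv.integral_mul_deriv_eq_deriv_mul acv
  have p2 := ac.integral_mul_deriv_eq_deriv_mul acv
  have p3 := ac'.integral_mul_deriv_eq_deriv_mul acv
  rw [v0, v1, dw] at p2
  rw [v0, v1, dw'] at p3
  have p4 : ∫ t in (0 : ℝ)..1, deriv v t * v t = ∫ t in (0 : ℝ)..1, v t * deriv v t :=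
    intervalIntegral.integral_congr fun t _ => mul_comm _ _
  rw [p4, v0, v1] at p1
  unfold form at hvt
  rw [e1, e2, e3, e4] at hvt
  have nn : 0 ≤ ∫ t in (0 : ℝ)..1, v t * v t :=
    intervalIntegral.integral_nonneg zero_le_one fun t _ => mul_self_nonneg _
  have nn' : 0 ≤ ∫ t in (0 : ℝ)..1, deriv v t * deriv v t :=
    intervalIntegral.integral_nonneg zero_le_one fun t _ => mul_self_nonneg _
  have zero : ∫ t in (0 : ℝ)..1, deriv v t * deriv v t = 0 := by
    have p1' : ∫ t in (0 : ℝ)..1, v t * deriv v t = 0 := by linarith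
    rw [p1', p2, p3] at hvt
    have h1 : ε * (∫ t in (0 : ℝ)..1, deriv v t * deriv v t) +
        c * ∫ t in (0 : ℝ)..1, v t * v t = 0 := by linear_combination hvt
    have h2 := mul_nonneg hc nn
    have h3 := mul_nonneg hε.le nn'
    have h4 : ε * (∫ t in (0 : ℝ)..1, deriv v t * deriv v t) = 0 := by linarith
    exact (mul_eq_zero.1 h4).resolve_left hε.ne'
  rw [intervalIntegral.integral_eq_zero_iff_of_le_of_nonneg_ae zero_le_one
    (Filter.Eventually.of_forall fun t => mul_self_nonneg _) ivv] at zero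
  intro t ht
  have hs : uIcc 0 t ⊆ uIcc (0 : ℝ) 1 := by
    rw [uIcc_of_le ht.1, uIcc_of_le zero_le_one]
    exact Icc_subset_Icc_right ht.2
  have hvt := (acv.mono hs).integral_deriv_eq_sub
  rw [intervalIntegral.integral_zero_ae, v0] at hvt
  · have : v t = u t - w t := rfl
    linarith
  · filter_upwards [(ae_restrict_iff' measurableSet_Ioc).1 zero] with s hs hmem
    rw [uIoc_of_le ht.1] at hmem
    exact mul_self_eq_zero.1 (hs ⟨hmem.1, hmem.2.trans ht.2⟩)

lemma deriv_eq_of_eqOn_Ioo {u w w' : ℝ → ℝ} {a b : ℝ} (h : ∀ t ∈ Ioo a b, u t = w t)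
    (hw : ∀ t, HasDerivAt w (w' t) t) : ∀ t ∈ Ioo a b, deriv u t = w' t := fun t ht => by
  have hev : u =ᶠ[nhds t] w := Filter.eventuallyEq_of_mem (Ioo_mem_nhds ht.1 ht.2) h
  rw [hev.deriv_eq, (hw t).deriv]

/-- The weak solution arises from a regular part by correcting its boundary values with the two
exponential solutions of the homogeneous equation. The one that decays from `0` appears with the
factor `-S 0`; the layer at `1` is normalised to vanish at `0`. -/
lemma IsRegularPart.exists_eq_add_layer {ε b c K : ℝ} {f F S S' S'' u : ℝ → ℝ} (hε : 0 < ε)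
    (hε1 : ε ≤ 1) (hc : 0 ≤ c) (hbc : b ≠ 0 ∨ c ≠ 0) (hu : IsWeakSolution ε b c f u)
    (hf : ∀ t ∈ Icc (0 : ℝ) 1, f t = F t) (hS : IsRegularPart ε b c K F S S' S'') :
    ∃ β, |β| ≤ 2 * K / (1 - Real.exp (-Real.sqrt (b ^ 2 + 4 * c))) ∧
      (∀ t ∈ Icc (0 : ℝ) 1, u t = S t + (-S 0 * Real.exp (decayRate ε b c * t) +
        β * (Real.exp (layerRate ε b c * (t - 1)) -
          Real.exp (-layerRate ε b c) * Real.exp (decayRate ε b c * t)))) ∧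
      ∀ t ∈ Ioo (0 : ℝ) 1, -ε * deriv (deriv u) t - b * deriv u t + c * u t = F t := by
  have hsum := layerRate_add_decayRate (b := b) (c := c) hε
  have hprod := layerRate_mul_decayRate (b := b) hε hc
  have hgap := sqrt_le_layerRate_sub_decayRate (b := b) hε hε1 hc
  have hr2 := decayRate_nonpos (b := b) hε hc
  have hpos : 0 < Real.sqrt (b ^ 2 + 4 * c) := by
    refine Real.sqrt_pos.2 ?_
    rcases hbc with h | h
    · have := pow_pos (abs_pos.2 h) 2
      rw [sq_abs] at this
      linarith
    · have := lt_of_le_of_ne hc h.symm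
      nlinarith [sq_nonneg b]
  generalize layerRate ε b c = r₁ at *
  generalize decayRate ε b c = r₂ at *
  set δ := 1 - Real.exp (-Real.sqrt (b ^ 2 + 4 * c)) with hδ
  have hδ0 : 0 < δ := by
    have : Real.exp (-Real.sqrt (b ^ 2 + 4 * c)) < 1 := Real.exp_lt_one_iff.2 (by linarith)
    linarith
  set d := 1 - Real.exp (-r₁) * Real.exp r₂ with hd
  have hdδ : δ ≤ d := by
    rw [hd, ← Real.exp_add, hδ]
    have := Real.exp_le_exp.2 (by linarith : -r₁ + r₂ ≤ -Real.sqrt (b ^ 2 + 4 * c))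
    linarith
  have hd0 : 0 < d := by linarith
  have dexp : ∀ r k t : ℝ, HasDerivAt (fun t => Real.exp (r * (t - k)))
      (r * Real.exp (r * (t - k))) t := fun r k t => by
    have := (((hasDerivAt_id t).sub_const k).const_mul r).exp
    simpa [mul_comm] using this
  have dexp' : ∀ r t : ℝ, HasDerivAt (fun t => Real.exp (r * t)) (r * Real.exp (r * t)) t :=
    fun r t => by simpa using dexp r 0 t
  have K0 : 0 ≤ K := (abs_nonneg _).trans hS.abs_one_le
  obtain ⟨β, hβ⟩ : ∃ β, β = (-S 1 + S 0 * Real.exp r₂) / d := ⟨_, rfl⟩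
  refine ⟨β, ?_, ?_⟩
  · rw [hβ, abs_div, abs_of_pos hd0]
    have h1 : |-S 1 + S 0 * Real.exp r₂| ≤ 2 * K := by
      refine (abs_add_le _ _).trans ?_
      rw [abs_neg, abs_mul, abs_of_pos (Real.exp_pos _)]
      have h2 := hS.abs_one_le
      have h3 := mul_le_of_le_one_right (abs_nonneg (S 0)) (Real.exp_le_one_iff.2 hr2)
      have h4 := hS.abs_zero_le
      linarith
    gcongr
  · have dw : ∀ t, HasDerivAt (fun t => S t + (-S 0 * Real.exp (r₂ * t) +
        β * (Real.exp (r₁ * (t - 1)) - Real.exp (-r₁) * Real.exp (r₂ * t))))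
        (S' t + (-S 0 * (r₂ * Real.exp (r₂ * t)) + β * (r₁ * Real.exp (r₁ * (t - 1)) -
        Real.exp (-r₁) * (r₂ * Real.exp (r₂ * t))))) t := fun t =>
      (hS.hasDerivAt t).add (((dexp' r₂ t).const_mul _).add
        (((dexp r₁ 1 t).sub ((dexp' r₂ t).const_mul _)).const_mul _))
    have dw' : ∀ t, HasDerivAt (fun t => S' t + (-S 0 * (r₂ * Real.exp (r₂ * t)) +
        β * (r₁ * Real.exp (r₁ * (t - 1)) - Real.exp (-r₁) * (r₂ * Real.exp (r₂ * t)))))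
        (S'' t + (-S 0 * (r₂ * (r₂ * Real.exp (r₂ * t))) +
        β * (r₁ * (r₁ * Real.exp (r₁ * (t - 1))) -
        Real.exp (-r₁) * (r₂ * (r₂ * Real.exp (r₂ * t)))))) t := fun t =>
      (hS.hasDerivAt' t).add ((((dexp' r₂ t).const_mul r₂).const_mul _).add
        ((((dexp r₁ 1 t).const_mul r₁).sub (((dexp' r₂ t).const_mul r₂).const_mul _)).const_mul _))
    have eqn : ∀ t, -ε * (S'' t + (-S 0 * (r₂ * (r₂ * Real.exp (r₂ * t))) +
        β * (r₁ * (r₁ * Real.exp (r₁ * (t - 1))) -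
        Real.exp (-r₁) * (r₂ * (r₂ * Real.exp (r₂ * t)))))) -
        b * (S' t + (-S 0 * (r₂ * Real.exp (r₂ * t)) + β * (r₁ * Real.exp (r₁ * (t - 1)) -
        Real.exp (-r₁) * (r₂ * Real.exp (r₂ * t))))) +
        c * (S t + (-S 0 * Real.exp (r₂ * t) +
        β * (Real.exp (r₁ * (t - 1)) - Real.exp (-r₁) * Real.exp (r₂ * t)))) = F t := fun t => by
      rw [← hS.equation t]
      have q1 : ε * r₁ ^ 2 + b * r₁ - c = 0 := by linear_combination r₁ * hsum - hprod
      have q2 : ε * r₂ ^ 2 + b * r₂ - c = 0 := by linear_combination r₂ * hsum - hprod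
      linear_combination -β * Real.exp (r₁ * (t - 1)) * q1 +
        (β * Real.exp (-r₁) + S 0) * Real.exp (r₂ * t) * q2
    have key := hu.eq_of_hasDerivAt hε hc dw dw'
      (by have := hS.continuous; fun_prop) (by simp)
      (by
        have h1 : β * d = -S 1 + S 0 * Real.exp r₂ := by
          rw [hβ]
          exact div_mul_cancel₀ _ hd0.ne'
        rw [hd] at h1
        simp only [sub_self, mul_zero, mul_one, Real.exp_zero]
        linear_combination h1)
      (fun t ht => (eqn t).trans (hf t ht).symm)
    refine ⟨key, fun t ht => ?_⟩
    have d1 := deriv_eq_of_eqOn_Ioo (fun s hs => key s (Ioo_subset_Icc_self hs)) dw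
    rw [deriv_eq_of_eqOn_Ioo d1 dw' t ht, d1 t ht, key t (Ioo_subset_Icc_self ht), eqn t]

/-- For `b = 0`, the absence of a layer at `0` forces the right-hand side to vanish there: the
differential equation gives `ε u'' → -f 0` at `0`. -/
lemma eq_zero_of_abs_deriv_deriv_le {c K : ℝ} {F : ℝ → ℝ} {u : ℝ → ℝ → ℝ}
    (cF : Continuous F) (cu : ∀ ε, 0 < ε → ε ≤ 1 → ContinuousOn (u ε) (Icc 0 1))
    (u0 : ∀ ε, 0 < ε → ε ≤ 1 → u ε 0 = 0)
    (eq : ∀ ε, 0 < ε → ε ≤ 1 → ∀ t ∈ Ioo (0 : ℝ) 1, -ε * deriv (deriv (u ε)) t + c * u ε t = F t)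
    (hK : ∀ ε, 0 < ε → ε ≤ 1 → ∀ t ∈ Ioo (0 : ℝ) (1 / 2), |deriv (deriv (u ε)) t| ≤ K) :
    F 0 = 0 := by
  have K0 : 0 ≤ K := (abs_nonneg _).trans (hK 1 one_pos le_rfl (1 / 4) ⟨by norm_num, by norm_num⟩)
  have bound : ∀ ε, 0 < ε → ε ≤ 1 → |F 0| ≤ ε * K := fun ε hε hε1 => by
    have c1 : ContinuousWithinAt (fun t => |F t - c * u ε t|) (Ioo (0 : ℝ) (1 / 2)) 0 := by
      have h1 : ContinuousWithinAt (u ε) (Ioo (0 : ℝ) (1 / 2)) 0 :=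
        ((cu ε hε hε1) 0 ⟨le_rfl, zero_le_one⟩).mono fun t ht => ⟨ht.1.le, by linarith [ht.2]⟩
      exact (cF.continuousWithinAt.sub (h1.const_mul c)).abs
    have hmem : (0 : ℝ) ∈ closure (Ioo (0 : ℝ) (1 / 2)) := by
      rw [closure_Ioo (by norm_num)]
      exact ⟨le_rfl, by norm_num⟩
    have := c1.closure_le hmem continuousWithinAt_const (g := fun _ => ε * K) fun t ht => by
      have e := eq ε hε hε1 t ⟨ht.1, by linarith [ht.2]⟩
      have e' : F t - c * u ε t = -ε * deriv (deriv (u ε)) t := by linear_combination -e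
      rw [e', abs_mul, abs_neg, abs_of_pos hε]
      exact mul_le_mul_of_nonneg_left (hK ε hε hε1 t ht) hε.le
    simpa [u0 ε hε hε1] using this
  by_contra h
  have h0 : 0 < |F 0| := abs_pos.2 h
  have hK1 : 0 < K + 1 := by linarith
  have hle : |F 0| ≤ K := by simpa using bound 1 one_pos le_rfl
  have := bound (|F 0| / (K + 1)) (by positivity) ((div_le_one hK1).2 (by linarith))
  rw [div_mul_eq_mul_div, le_div_iff₀ hK1] at this
  linarith

lemma abs_layer_le {r₁ r₂ t : ℝ} (h : 0 ≤ r₁) (h' : r₂ ≤ 0) (ht : 0 ≤ t) :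
    |Real.exp (r₁ * (t - 1)) - Real.exp (-r₁) * Real.exp (r₂ * t)| ≤ Real.exp (r₁ * (t - 1)) := by
  have h1 : Real.exp (-r₁) * Real.exp (r₂ * t) ≤ Real.exp (r₁ * (t - 1)) := by
    rw [← Real.exp_add]
    refine Real.exp_le_exp.2 ?_
    nlinarith [mul_nonneg h ht, mul_nonneg (neg_nonneg.2 h') ht]
  have h2 : 0 < Real.exp (-r₁) * Real.exp (r₂ * t) := by positivity
  rw [abs_of_nonneg (by linarith)]
  linarith

end SPFem

namespace SPFem

/-- Under the hypothesis on layers, the regular part can be chosen to vanish at `0`, with bounds that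
are uniform in `ε`. -/
lemma exists_uniform_isRegularPart {b c : ℝ} (hb : b ≤ 0) (hc : 0 ≤ c) (hbc : b ≠ 0 ∨ c ≠ 0)
    {f F F' F'' : ℝ → ℝ} {u : ℝ → ℝ → ℝ}
    (hu : ∀ ε, 0 < ε → ε ≤ 1 → IsWeakSolution ε b c f (u ε)) (hlayer : BoundaryLayerAtOne u)
    (hF : ∀ t, HasDerivAt F (F' t) t) (hF' : ∀ t, HasDerivAt F' (F'' t) t) (cF : Continuous F'')
    (hf : ∀ t ∈ Icc (0 : ℝ) 1, f t = F t) :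
    ∃ K, ∀ ε, 0 < ε → ε ≤ 1 → ∃ S S' S'', IsRegularPart ε b c K F S S' S'' ∧ S 0 = 0 := by
  have cF0 : Continuous F := continuous_iff_continuousAt.2 fun t => (hF t).continuousAt
  have cF1 : Continuous F' := continuous_iff_continuousAt.2 fun t => (hF' t).continuousAt
  obtain ⟨M₀, h0⟩ := (isCompact_Icc (a := (0 : ℝ)) (b := 1)).exists_bound_of_continuousOn
    cF0.continuousOn
  obtain ⟨M₁, h1⟩ := (isCompact_Icc (a := (0 : ℝ)) (b := 1)).exists_bound_of_continuousOn
    cF1.continuousOn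
  obtain ⟨M₂, h2⟩ := (isCompact_Icc (a := (0 : ℝ)) (b := 1)).exists_bound_of_continuousOn
    cF.continuousOn
  have bF : ∀ t ∈ Icc (0 : ℝ) 1, |F t| ≤ max M₀ (max M₁ M₂) ∧ |F' t| ≤ max M₀ (max M₁ M₂) ∧
      |F'' t| ≤ max M₀ (max M₁ M₂) := fun t ht =>
    ⟨(h0 t ht).trans (le_max_left _ _),
      (h1 t ht).trans ((le_max_left _ _).trans (le_max_right _ _)),
      (h2 t ht).trans ((le_max_right _ _).trans (le_max_right _ _))⟩
  rcases hb.lt_or_eq with hb | rfl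
  · exact exists_isRegularPart_of_neg hb hc hF hF' cF bF
  · have hc' : 0 < c := lt_of_le_of_ne hc (hbc.resolve_left (not_not.2 rfl)).symm
    obtain ⟨K, hK⟩ := exists_isRegularPart_of_eq_zero hc' hF hF' cF bF
    obtain ⟨K', hK'⟩ := hlayer (1 / 2) (by norm_num)
    have F0 : F 0 = 0 := by
      refine eq_zero_of_abs_deriv_deriv_le (c := c) (u := u) (K := K') cF0
        (fun ε hε hε1 => ?_) (fun ε hε hε1 => (hu ε hε hε1).1.2.2.1) (fun ε hε hε1 t ht => ?_)
        (fun ε hε hε1 t ht => hK' ε hε hε1 t ⟨ht.1, by linarith [ht.2]⟩)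
      · have := (hu ε hε hε1).1.1.continuousOn
        rwa [uIcc_of_le zero_le_one] at this
      · obtain ⟨S, S', S'', hS, -⟩ := hK ε hε hε1
        obtain ⟨β, -, -, h⟩ := hS.exists_eq_add_layer hε hε1 hc hbc (hu ε hε hε1) hf
        simpa using h t ht
    refine ⟨K, fun ε hε hε1 => ?_⟩
    obtain ⟨S, S', S'', hS, S0⟩ := hK ε hε hε1
    exact ⟨S, S', S'', hS, by rw [S0, F0, zero_div]⟩

/-! ### The uniform grid and the points `Q_i` -/

section UniformGrid

variable {n : ℕ}

lemma uniformGrid_succ (i : ℕ) :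
    uniformGrid n (i + 1) = uniformGrid n i + 1 / ((n : ℝ) + 1) := by
  simp only [uniformGrid]
  push_cast
  ring

lemma uniformGrid_pred {i : ℕ} (hi : 1 ≤ i) :
    uniformGrid n (i - 1) = uniformGrid n i - 1 / ((n : ℝ) + 1) := by
  obtain ⟨k, rfl⟩ : ∃ k, i = k + 1 := ⟨i - 1, by omega⟩
  rw [uniformGrid_succ, Nat.add_sub_cancel]
  ring

lemma uniformGrid_mem_Icc {i : ℕ} (hi : i ≤ n + 1) : uniformGrid n i ∈ Icc (0 : ℝ) 1 := by
  have h := isGrid_uniformGrid n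
  exact ⟨h.1 ▸ h.le_of_le (Nat.zero_le i) hi, h.2.1 ▸ h.le_of_le hi le_rfl⟩

lemma uniformGrid_step_bounds {j : ℕ} (hj : 1 ≤ j) (hjn : j ≤ n) :
    0 ≤ uniformGrid n j - 1 / ((n : ℝ) + 1) ∧ uniformGrid n j + 1 / ((n : ℝ) + 1) ≤ 1 := by
  rw [← uniformGrid_pred hj, ← uniformGrid_succ]
  exact ⟨(uniformGrid_mem_Icc (by omega)).1, (uniformGrid_mem_Icc (by omega)).2⟩

lemma form_nodal_uniformGrid {ε b c : ℝ} {U : ℝ → ℝ} {j : ℕ} (hj : 1 ≤ j) (hjn : j ≤ n)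
    (hU : AffineOnIcc U (uniformGrid n (j - 1)) (uniformGrid n j))
    (hU' : AffineOnIcc U (uniformGrid n j) (uniformGrid n (j + 1))) :
    form ε b c U (nodal (uniformGrid n) j) =
      lowerCoeff ε b c (1 / ((n : ℝ) + 1)) * U (uniformGrid n (j - 1)) +
      diagCoeff ε c (1 / ((n : ℝ) + 1)) * U (uniformGrid n j) +
      upperCoeff ε b c (1 / ((n : ℝ) + 1)) * U (uniformGrid n (j + 1)) :=
  form_nodal (by positivity) (uniformGrid_pred hj) (uniformGrid_succ j)
    (uniformGrid_step_bounds hj hjn).1 (uniformGrid_step_bounds hj hjn).2 hU hU'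

/-- By Cramer's rule, the determinants `det A_i` are the nodal values of a multiple of the discrete
Green's function at the last node; they satisfy the homogeneous three-term recurrence. The value at
the boundary node `0` is set to `0`. -/
lemma detA_recurrence (ε b c : ℝ) {j : ℕ} (hj : 1 ≤ j) (hjn : j < n) :
    lowerCoeff ε b c (1 / ((n : ℝ) + 1)) *
        (if j - 1 = 0 then 0 else detA ε b c n (uniformGrid n) (j - 1)) +
      diagCoeff ε c (1 / ((n : ℝ) + 1)) * detA ε b c n (uniformGrid n) j +
      upperCoeff ε b c (1 / ((n : ℝ) + 1)) * detA ε b c n (uniformGrid n) (j + 1) = 0 := by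
  have hx := isGrid_uniformGrid n
  set x := uniformGrid n with hxdef
  set A := stiffness ε b c n x with hA
  set e : Fin n → ℝ := fun k => if (k : ℕ) + 1 = n then 1 else 0 with he
  have hcr : ∀ i : Fin n, A.cramer e i = detA ε b c n x ((i : ℕ) + 1) := fun i => by
    rw [Matrix.cramer_apply, detA]
    congr 1
    ext k l
    simp only [Matrix.updateCol_apply, Matrix.of_apply, he, hA, Fin.ext_iff,
      Nat.add_right_cancel_iff]
  have val : ∀ i ≤ n, ∑ k : Fin n, A.cramer e k * nodal x ((k : ℕ) + 1) (x i) =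
      if i = 0 then 0 else detA ε b c n x i := fun i hi => by
    split_ifs with h
    · refine Finset.sum_eq_zero fun k _ => ?_
      have := k.isLt
      rw [hx.nodal_node (by omega) (by omega) (by omega), if_neg (by omega), mul_zero]
    · have h1 := hx.sum_nodal_node (A.cramer e) ⟨i - 1, by omega⟩
      have h2 := hcr ⟨i - 1, by omega⟩
      simp only [Nat.sub_add_cancel (Nat.one_le_iff_ne_zero.2 h)] at h1 h2
      rw [h1, h2]
  have row := congrFun (Matrix.mulVec_cramer A e) ⟨j - 1, by omega⟩
  have he0 : e ⟨j - 1, by omega⟩ = 0 := by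
    simp only [he]
    rw [if_neg (by omega)]
  rw [Pi.smul_apply, he0, smul_zero, Matrix.mulVec, dotProduct] at row
  rw [← val (j - 1) (by omega)]
  have v1 := val j (by omega)
  have v2 := val (j + 1) (by omega)
  rw [if_neg (by omega)] at v1 v2
  rw [← v1, ← v2, ← row, Finset.mul_sum, Finset.mul_sum, Finset.mul_sum,
    ← Finset.sum_add_distrib, ← Finset.sum_add_distrib]
  refine Finset.sum_congr rfl fun k _ => ?_
  have hk := k.isLt
  have haff : ∀ i ≤ n, AffineOnIcc (nodal x ((k : ℕ) + 1)) (x i) (x (i + 1)) := fun i hi =>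
    hx.affineOnIcc_nodal (by omega) (by omega) hi
  have hl := haff (j - 1) (by omega)
  rw [Nat.sub_add_cancel hj] at hl
  have hf := form_nodal_uniformGrid (ε := ε) (b := b) (c := c) hj hjn.le hl (haff j hjn.le)
  simp only [hA, stiffness, Matrix.of_apply, Nat.sub_add_cancel hj]
  rw [hf]
  ring

/-- The discrete layer function: the absolute values, up to normalisation, of an alternating
solution of the homogeneous recurrence. It determines the points `Q_i`. -/
lemma exists_alternating_solution {ε b c : ℝ} (hn : 2 ≤ n)
    (hsign : SignCondition ε b c n (uniformGrid n)) :
    ∃ γ : ℕ → ℝ, γ 0 = 0 ∧ (∀ i, 1 ≤ i → i ≤ n → 0 < γ i) ∧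
      (∀ i, 1 ≤ i → i < n → upperCoeff ε b c (1 / ((n : ℝ) + 1)) * γ (i + 1) =
        diagCoeff ε c (1 / ((n : ℝ) + 1)) * γ i -
          lowerCoeff ε b c (1 / ((n : ℝ) + 1)) * γ (i - 1)) ∧
      ∀ i, 2 ≤ i → i ≤ n → abscissaQ ε b c n (uniformGrid n) i =
        (γ (i - 1) * uniformGrid n i + γ i * uniformGrid n (i - 1)) / (γ (i - 1) + γ i) := by
  have hrec := fun j => detA_recurrence (n := n) ε b c (j := j)
  have hg : ∀ i, 2 ≤ i → i ≤ n → detA ε b c n (uniformGrid n) i *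
    detA ε b c n (uniformGrid n) (i - 1) < 0 := hsign
  generalize hgdef : detA ε b c n (uniformGrid n) = g at hrec hg
  have g1 : g 1 ≠ 0 := right_ne_zero_of_mul (hg 2 le_rfl hn).ne
  have pos := alternating_normalised_pos hg g1
  set γ : ℕ → ℝ := fun i => if i = 0 then 0 else (-1) ^ (i + 1) * g i / g 1 with hγ
  have γs : ∀ i, 1 ≤ i → γ i = (-1) ^ (i + 1) * g i / g 1 := fun i hi => by
    simp only [hγ]
    rw [if_neg (by omega)]
  have γpos : ∀ i, 1 ≤ i → i ≤ n → 0 < γ i := fun i hi hin => by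
    rw [γs i hi]
    exact pos i hi hin
  refine ⟨γ, by simp [hγ], γpos, fun i hi hin => ?_, fun i hi hin => ?_⟩
  · have h := hrec i hi hin
    have hprev : γ (i - 1) = (-1) ^ i * (if i - 1 = 0 then 0 else g (i - 1)) / g 1 := by
      simp only [hγ]
      split_ifs with h0
      · simp
      · rw [Nat.sub_add_cancel hi]
    rw [γs i hi, γs (i + 1) (by omega), hprev]
    field_simp
    rw [pow_succ, pow_succ]
    linear_combination (-1) ^ i * h
  · have p1 := γpos (i - 1) (by omega) (by omega)
    have p2 := γpos i (by omega) hin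
    have hr : |g (i - 1) / g i| = γ (i - 1) / γ i := by
      rw [← abs_of_pos (div_pos p1 p2), γs i (by omega), γs (i - 1) (by omega), abs_div, abs_div,
        abs_div, abs_div, abs_mul, abs_mul, abs_pow, abs_pow, abs_neg, abs_one, one_pow, one_pow,
        one_mul, one_mul, div_div_div_cancel_right₀ (abs_ne_zero.2 g1)]
    simp only [abscissaQ, hgdef]
    rw [hr]
    field_simp

end UniformGrid

end SPFem

lemma AffineOnIcc.eq_of_weights {w : ℝ → ℝ} {a b p q : ℝ} (hw : AffineOnIcc w a b) (hab : a < b)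
    (hp : 0 < p) (hq : 0 < q) : (p * b + q * a) / (p + q) ∈ Ioo a b ∧
      w ((p * b + q * a) / (p + q)) = (p * w b + q * w a) / (p + q) := by
  have hmem : (p * b + q * a) / (p + q) ∈ Ioo a b := by
    constructor
    · rw [lt_div_iff₀ (by positivity)]
      nlinarith
    · rw [div_lt_iff₀ (by positivity)]
      nlinarith
  refine ⟨hmem, ?_⟩
  have hne : b - a ≠ 0 := by linarith
  rw [hw.eq hab (Ioo_subset_Icc_self hmem)]
  field_simp
  ring

namespace SPFem

section Intersection

variable {ε b c : ℝ} {f : ℝ → ℝ} {n : ℕ} {γ : ℕ → ℝ}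

/-- A refinement to the right of `x n` leaves the equations at the first `n - 1` nodes unchanged. -/
lemma IsFEMSolution.recurrence {m : ℕ} {y : ℕ → ℝ} {U : ℝ → ℝ} (hy : IsGrid (n + m) y)
    (hyx : ∀ j ≤ n, y j = uniformGrid n j) (hU : IsFEMSolution ε b c f (n + m) y U) :
    U 0 = 0 ∧ (∀ j, 1 ≤ j → j ≤ n → AffineOnIcc U (uniformGrid n (j - 1)) (uniformGrid n j)) ∧
      ∀ j, 1 ≤ j → j < n →
        lowerCoeff ε b c (1 / ((n : ℝ) + 1)) * U (uniformGrid n (j - 1)) +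
          diagCoeff ε c (1 / ((n : ℝ) + 1)) * U (uniformGrid n j) +
          upperCoeff ε b c (1 / ((n : ℝ) + 1)) * U (uniformGrid n (j + 1)) =
        l2 f (nodal (uniformGrid n) j) := by
  obtain ⟨haff, h0⟩ := hy.feSpace_properties hU.1
  have haff' : ∀ j, 1 ≤ j → j ≤ n →
      AffineOnIcc U (uniformGrid n (j - 1)) (uniformGrid n j) := fun j hj hjn => by
    have h := haff (j - 1) (by omega)
    rwa [Nat.sub_add_cancel hj, hyx (j - 1) (by omega), hyx j hjn] at h
  refine ⟨hy.1 ▸ h0, haff', fun j hj hjn => ?_⟩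
  have hnodal : nodal (uniformGrid n) j = nodal y j := by
    ext t
    simp only [nodal]
    rw [hyx (j - 1) (by omega), hyx j hjn.le, hyx (j + 1) (by omega)]
  rw [← form_nodal_uniformGrid hj hjn.le (haff' j hj hjn.le)
    (haff' (j + 1) (by omega) (by omega)), hnodal]
  exact hU.2 _ (nodal_mem_feSpace hj (by omega))

lemma isIntersection_of_alternating {un : ℝ → ℝ} {i : ℕ}
    (hp : upperCoeff ε b c (1 / ((n : ℝ) + 1)) ≠ 0) (γ0 : γ 0 = 0)
    (γpos : ∀ i, 1 ≤ i → i ≤ n → 0 < γ i)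
    (hγ : ∀ i, 1 ≤ i → i < n → upperCoeff ε b c (1 / ((n : ℝ) + 1)) * γ (i + 1) =
        diagCoeff ε c (1 / ((n : ℝ) + 1)) * γ i -
          lowerCoeff ε b c (1 / ((n : ℝ) + 1)) * γ (i - 1))
    (hun : IsFEMSolution ε b c f n (uniformGrid n) un) (hi : 2 ≤ i) (hin : i ≤ n) :
    IsIntersection ε b c f n (uniformGrid n) un i
      ((γ (i - 1) * uniformGrid n i + γ i * uniformGrid n (i - 1)) / (γ (i - 1) + γ i)) := by
  obtain ⟨z, hz, rz⟩ := IsFEMSolution.recurrence (m := 0) (isGrid_uniformGrid n)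
    (fun _ _ => rfl) hun
  have hx := isGrid_uniformGrid n
  have hlt : uniformGrid n (i - 1) < uniformGrid n i := hx.lt_of_lt (by omega) (by omega)
  have p1 := γpos (i - 1) (by omega) (by omega)
  have p2 := γpos i (by omega) hin
  have hzi := hz i (by omega) hin
  refine ⟨(hzi.eq_of_weights hlt p1 p2).1, fun m y U hy hyx hU => ?_⟩
  obtain ⟨o, ho, ro⟩ := hU.recurrence hy hyx
  have hoi := ho i (by omega) hin
  set w : ℕ → ℝ := fun j => U (uniformGrid n j) - un (uniformGrid n j) with hw
  have w0 : w 0 = 0 := by simp [hw, hx.1, o, z]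
  have cas : ∀ j, 1 ≤ j → j ≤ n → w (j - 1) * γ j + w j * γ (j - 1) = 0 := by
    intro j hj
    induction j, hj using Nat.le_induction with
    | base => intro _; simp [γ0, w0]
    | succ k hk ih =>
      intro hkn
      have h1 := casoratian_succ (e₀ := w (k - 1)) (e₁ := w k) (e₂ := w (k + 1)) (τ := 0)
        (hγ k hk (by omega)) (by
          simp only [hw]
          linear_combination ro k hk (by omega) - rz k hk (by omega))
      rw [ih (by omega)] at h1
      rw [Nat.add_sub_cancel]
      rw [mul_zero, mul_zero, add_zero] at h1
      exact (mul_eq_zero.1 h1).resolve_left hp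
  have casi := cas i (by omega) hin
  have hwi : w i = U (uniformGrid n i) - un (uniformGrid n i) := rfl
  have hwi' : w (i - 1) = U (uniformGrid n (i - 1)) - un (uniformGrid n (i - 1)) := rfl
  have hW : ∀ t ∈ Icc (uniformGrid n (i - 1)) (uniformGrid n i),
      (U t - un t) * (uniformGrid n i - uniformGrid n (i - 1)) =
        w (i - 1) * (uniformGrid n i - t) + w i * (t - uniformGrid n (i - 1)) := fun t ht => by
    rw [hwi, hwi']
    linear_combination hoi t ht - hzi t ht
  constructor
  · rw [(hoi.eq_of_weights hlt p1 p2).2, (hzi.eq_of_weights hlt p1 p2).2]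
    congr 1
    rw [hwi, hwi'] at casi
    linear_combination casi
  · by_cases h : w i = 0
    · right
      have h' : w (i - 1) = 0 := by
        rw [h, zero_mul, add_zero] at casi
        exact (mul_eq_zero.1 casi).resolve_right p2.ne'
      intro t ht
      have h1 := hW t ht
      rw [h, h', zero_mul, zero_mul, add_zero] at h1
      have := (mul_eq_zero.1 h1).resolve_right (by linarith)
      linarith
    · left
      intro t ht hUt
      have h1 := hW t (Ioo_subset_Icc_self ht)
      rw [hUt, sub_self, zero_mul] at h1
      have h2 : w i * (t * (γ (i - 1) + γ i) -
          (γ (i - 1) * uniformGrid n i + γ i * uniformGrid n (i - 1))) = 0 := by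
        linear_combination -γ i * h1 - (uniformGrid n i - t) * casi
      rw [eq_div_iff (by positivity)]
      linarith [(mul_eq_zero.1 h2).resolve_left h]

end Intersection

/-! ### The error at the points `Q_i` -/

/-- The scheme is stable for solutions measured at the points `Q_i`, uniformly in `ε` and `h`. -/
lemma exists_casoratian_bound {b c : ℝ} (hb : b ≤ 0) (hc : 0 ≤ c) (hbc : b ≠ 0 ∨ c ≠ 0) :
    ∃ B, 0 ≤ B ∧ ∀ (ε h T : ℝ) (n : ℕ) (γ e τ : ℕ → ℝ), 0 < ε → 0 < h → (n : ℝ) * h ≤ 1 → 0 ≤ T →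
      0 < upperCoeff ε b c h → γ 0 = 0 → (∀ i, 1 ≤ i → i ≤ n → 0 < γ i) →
      (∀ i, 1 ≤ i → i < n → upperCoeff ε b c h * γ (i + 1) =
        diagCoeff ε c h * γ i - lowerCoeff ε b c h * γ (i - 1)) → e 0 = 0 →
      (∀ i, 1 ≤ i → i < n → lowerCoeff ε b c h * e (i - 1) + diagCoeff ε c h * e i +
        upperCoeff ε b c h * e (i + 1) = τ i) → (∀ i, 1 ≤ i → i < n → |τ i| ≤ T) →
      ∀ i, 1 ≤ i → i ≤ n →
        |e (i - 1) * γ i + e i * γ (i - 1)| ≤ B * (T / h) * (γ i + γ (i - 1)) := by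
  rcases hc.eq_or_lt with rfl | hc
  · have hb : b < 0 := lt_of_le_of_ne hb (by simpa using hbc)
    refine ⟨2 / -b, div_nonneg (by norm_num) (by linarith), ?_⟩
    intro ε h T n γ e τ hε hh hnh hT hp γ0 γpos hγ e0 he hτ i hi hin
    have hεh : 0 < ε / h := by positivity
    have hl : -b / 2 ≤ -lowerCoeff ε b 0 h := by
      unfold lowerCoeff
      linarith
    have hb2 : 0 < -b / 2 := by linarith
    have hq : 0 ≤ T / -lowerCoeff ε b 0 h := div_nonneg hT (by linarith)
    refine (casoratian_bound_of_rowSum_zero hp (by linarith) (by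
      unfold lowerCoeff diagCoeff upperCoeff; ring) γ0 γpos hγ e0 he hτ hT i hi hin).trans ?_
    have hD : 0 ≤ γ i + γ (i - 1) := by
      have h1 := γpos i hi hin
      rcases Nat.eq_zero_or_pos (i - 1) with h2 | h2
      · rw [h2, γ0]; linarith
      · linarith [γpos (i - 1) h2 (by omega)]
    refine mul_le_mul_of_nonneg_right ?_ hD
    have hi' : (i : ℝ) ≤ 1 / h := by
      rw [le_div_iff₀ hh]
      exact le_trans (by gcongr) hnh
    calc (i : ℝ) * (T / -lowerCoeff ε b 0 h) ≤ 1 / h * (T / (-b / 2)) := by gcongr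
      _ = 2 / -b * (T / h) := by
        have : -b ≠ 0 := by linarith
        field_simp
  · refine ⟨3 / c, by positivity, ?_⟩
    intro ε h T n γ e τ hε hh hnh hT hp γ0 γpos hγ e0 he hτ i hi hin
    have hεh : 0 < ε / h := by positivity
    have hch : 0 < c * h := by positivity
    refine (casoratian_bound_of_rowSum_pos hp hch (by
      unfold lowerCoeff diagCoeff upperCoeff; ring) (by unfold lowerCoeff; linarith)
      (by unfold lowerCoeff diagCoeff upperCoeff; linarith) γ0 γpos hγ e0 he hτ hT i hi
      hin).trans (le_of_eq ?_)
    field_simp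

end SPFem

theorem mainTheorem6 (b c : ℝ) (hb : b ≤ 0) (hc : 0 ≤ c) (hbc : b ≠ 0 ∨ c ≠ 0)
    (f : ℝ → ℝ) (hf : ContDiffOn ℝ 2 f (Set.Icc 0 1))
    (u : ℝ → ℝ → ℝ)
    (hu : ∀ ε, 0 < ε → ε ≤ 1 → SPFem.IsWeakSolution ε b c f (u ε))
    (hlayer : SPFem.BoundaryLayerAtOne u) (κ : ℝ) :
    ∃ C : ℝ, ∀ (ε : ℝ) (n : ℕ) (un : ℝ → ℝ), 0 < ε → ε ≤ 1 → 2 ≤ n →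
      SPFem.SignCondition ε b c n (SPFem.uniformGrid n) →
      SPFem.OutsideLayer κ ε b c n (SPFem.uniformGrid n n) →
      SPFem.IsFEMSolution ε b c f n (SPFem.uniformGrid n) un →
      ∀ i, 2 ≤ i → i ≤ n →
        SPFem.IsIntersection ε b c f n (SPFem.uniformGrid n) un i
            (SPFem.abscissaQ ε b c n (SPFem.uniformGrid n) i) ∧
          |un (SPFem.abscissaQ ε b c n (SPFem.uniformGrid n) i) -
              SPFem.interp n (SPFem.uniformGrid n) (u ε)
                (SPFem.abscissaQ ε b c n (SPFem.uniformGrid n) i)| < C / (n : ℝ) ^ 2 := by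
  obtain ⟨F, F', F'', hF, hF', cF, hfF⟩ := exists_extension_of_contDiffOn_two hf
  have cF0 : Continuous F := continuous_iff_continuousAt.2 fun t => (hF t).continuousAt
  obtain ⟨K, hK⟩ := SPFem.exists_uniform_isRegularPart hb hc hbc hu hlayer hF hF' cF hfF
  obtain ⟨B, hB, hstab⟩ := SPFem.exists_casoratian_bound hb hc hbc
  obtain ⟨L, hL⟩ : ∃ L, L = 2 * K / (1 - Real.exp (-Real.sqrt (b ^ 2 + 4 * c))) := ⟨_, rfl⟩
  refine ⟨B * (3 * (1 + c) * K) + L * κ + 1, ?_⟩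
  intro ε n un hε hε1 hn hsign hout hun i hi hin
  obtain ⟨γ, γ0, γpos, hγ, hQ⟩ := SPFem.exists_alternating_solution hn hsign
  rw [hQ i hi hin]
  have hx := SPFem.isGrid_uniformGrid n
  obtain ⟨h, hh⟩ : ∃ h : ℝ, h = 1 / ((n : ℝ) + 1) := ⟨_, rfl⟩
  have hn0 : (0 : ℝ) < n := by positivity
  have hh0 : 0 < h := by rw [hh]; positivity
  have hnh : (n : ℝ) * h ≤ 1 := by
    rw [hh, mul_one_div, div_le_one (by positivity)]
    linarith
  -- The sign condition makes the superdiagonal entry positive.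
  have hp : 0 < SPFem.upperCoeff ε b c h := by
    have h1 := hγ 1 le_rfl (by omega)
    have h2 := γpos 1 le_rfl (by omega)
    have h3 := γpos 2 (by omega) hn
    rw [Nat.sub_self, γ0, mul_zero, sub_zero, ← hh] at h1
    have h4 : 0 < SPFem.diagCoeff ε c h := by
      unfold SPFem.diagCoeff
      positivity
    have h5 : 0 < SPFem.upperCoeff ε b c h * γ 2 := by
      rw [h1]
      positivity
    exact pos_of_mul_pos_left h5 h3.le
  refine ⟨SPFem.isIntersection_of_alternating (hh ▸ hp.ne') γ0 γpos hγ hun hi hin, ?_⟩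
  obtain ⟨S, S', S'', hS, S0⟩ := hK ε hε hε1
  obtain ⟨β, hβ, hdec, -⟩ := hS.exists_eq_add_layer hε hε1 hc hbc (hu ε hε hε1) hfF
  have K0 : 0 ≤ K := (abs_nonneg _).trans hS.abs_one_le
  obtain ⟨z, hz, rz⟩ := SPFem.IsFEMSolution.recurrence (m := 0) hx (fun _ _ => rfl) hun
  set x := SPFem.uniformGrid n with hxdef
  -- The error against the regular part at the nodes.
  have cas := hstab ε h (3 * (1 + c) * K * h ^ 3) n γ (fun j => un (x j) - S (x j))
    (fun j => SPFem.l2 f (SPFem.nodal x j) - (SPFem.lowerCoeff ε b c h * S (x (j - 1)) +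
      SPFem.diagCoeff ε c h * S (x j) + SPFem.upperCoeff ε b c h * S (x (j + 1))))
    hε hh0 hnh (by positivity) hp γ0 γpos (hh ▸ hγ) (by simp only [hx.1, z, S0, sub_zero])
    (fun j hj hjn => by
      have := rz j hj hjn
      rw [← hh] at this
      linear_combination this)
    (fun j hj hjn => by
      have hb := SPFem.uniformGrid_step_bounds hj hjn.le
      rw [← hh] at hb
      exact SPFem.abs_truncation_le hc K0 hh0 (hh ▸ SPFem.uniformGrid_pred hj)
        (hh ▸ SPFem.uniformGrid_succ j) hb.1 hb.2 hfF cF0 hS.hasDerivAt hS.hasDerivAt'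
        hS.continuous (fun t _ => hS.equation t) hS.abs_le hS.lipschitz)
    i (by omega) hin
  have hκ : 0 ≤ κ / (n : ℝ) ^ 2 := (Real.exp_pos _).le.trans hout
  have L0 : 0 ≤ L := (abs_nonneg _).trans (hL ▸ hβ)
  have lay : ∀ j, j ≤ n → |u ε (x j) - S (x j)| ≤ L * (κ / (n : ℝ) ^ 2) := by
    intro j hj
    have hmem : x j ∈ Icc (0 : ℝ) 1 := SPFem.uniformGrid_mem_Icc (by omega)
    have hlam := SPFem.layerRate_nonneg (c := c) hε hb
    have hmono : x j ≤ x n := hx.le_of_le hj (by omega)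
    rw [hdec (x j) hmem, S0, neg_zero, zero_mul, zero_add, add_sub_cancel_left, abs_mul]
    refine mul_le_mul (hL ▸ hβ) ?_ (abs_nonneg _) L0
    refine (SPFem.abs_layer_le hlam (SPFem.decayRate_nonpos hε hc) hmem.1).trans ?_
    refine le_trans (Real.exp_le_exp.2 ?_) hout
    nlinarith
  have p1 := γpos (i - 1) (by omega) (by omega)
  have p2 := γpos i (by omega) hin
  have hlt : x (i - 1) < x i := hx.lt_of_lt (by omega) (by omega)
  have hI := (hx.feSpace_properties (SPFem.interp_mem_feSpace (N := n) (x := x) (u ε))).1 (i - 1)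
    (by omega)
  rw [Nat.sub_add_cancel (by omega : 1 ≤ i)] at hI
  rw [((hz i (by omega) hin).eq_of_weights hlt p1 p2).2, (hI.eq_of_weights hlt p1 p2).2,
    hx.interp_node _ (by omega : 1 ≤ i) hin, hx.interp_node _ (by omega : 1 ≤ i - 1) (by omega)]
  have l1 := lay i hin
  have l2 := lay (i - 1) (by omega)
  have hD : 0 < γ (i - 1) + γ i := by linarith
  have hh2 : B * (3 * (1 + c) * K * h ^ 3 / h) ≤ B * (3 * (1 + c) * K) / (n : ℝ) ^ 2 := by
    have e : B * (3 * (1 + c) * K * h ^ 3 / h) = B * (3 * (1 + c) * K) * h ^ 2 := by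
      field_simp
    rw [e, le_div_iff₀ (by positivity), mul_assoc]
    refine mul_le_of_le_one_right (by positivity) ?_
    have : ((n : ℝ) * h) ^ 2 ≤ 1 := pow_le_one₀ (by positivity) hnh
    linarith [mul_pow (n : ℝ) h 2]
  have split : (γ (i - 1) * un (x i) + γ i * un (x (i - 1))) / (γ (i - 1) + γ i) -
      (γ (i - 1) * u ε (x i) + γ i * u ε (x (i - 1))) / (γ (i - 1) + γ i) =
      (((un (x (i - 1)) - S (x (i - 1))) * γ i + (un (x i) - S (x i)) * γ (i - 1)) -
        (γ (i - 1) * (u ε (x i) - S (x i)) + γ i * (u ε (x (i - 1)) - S (x (i - 1))))) /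
        (γ (i - 1) + γ i) := by
    rw [← sub_div]
    congr 1
    ring
  have layD : |γ (i - 1) * (u ε (x i) - S (x i)) + γ i * (u ε (x (i - 1)) - S (x (i - 1)))| ≤
      L * (κ / (n : ℝ) ^ 2) * (γ (i - 1) + γ i) := by
    refine (abs_add_le _ _).trans ?_
    rw [abs_mul, abs_mul, abs_of_pos p1, abs_of_pos p2]
    nlinarith
  rw [split, abs_div, abs_of_pos hD, div_lt_iff₀ hD]
  have hlt1 : 0 < 1 / (n : ℝ) ^ 2 * (γ (i - 1) + γ i) := by positivity
  have hfin : (B * (3 * (1 + c) * K) + L * κ + 1) / (n : ℝ) ^ 2 =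
      B * (3 * (1 + c) * K) / (n : ℝ) ^ 2 + L * (κ / (n : ℝ) ^ 2) + 1 / (n : ℝ) ^ 2 := by ring
  rw [hfin]
  have h6 := mul_le_mul_of_nonneg_right hh2 hD.le
  rw [add_comm (γ i) (γ (i - 1))] at cas
  calc _ ≤ _ := abs_sub _ _
    _ ≤ B * (3 * (1 + c) * K * h ^ 3 / h) * (γ (i - 1) + γ i) +
        L * (κ / (n : ℝ) ^ 2) * (γ (i - 1) + γ i) := add_le_add cas layD
    _ < _ := by linarith
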